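/- All rings are commutative with $1$. For a ring $A$, an ideal $\mathfrak q$ and $n\ge 1$, let $SL(n,A;\mathfrak q)$ be the group of matrices in $SL(n,A)$ congruent to the identity modulo $\mathfrak q$; let $LU(n,\mathfrak q)$ be the set of elementary matrices $E_{i,j}(a)$ with $i\neq j$, $a\in\mathfrak q$ (that is, $E_{i,j}(a)-I$ has $(i,j)$ entry $a$ and all other entries $0$); let $E(n,A)$ be the group generated by $LU(n,A)$; and let $E^{\triangleleft}(n,A;\mathfrak q)$ be the group generated by all $E(n,A)$-conjugates of elements of $LU(n,\mathfrak q)$. Let $W(\mathfrak q)$ be the set of pairs $(a,b)\in A\times A$ with $a-1\in\mathfrak q$, $b\in\mathfrak q$ and $aA+bA=A$. For a unit $u$ put $H(u)=\mathrm{diag}(u,u^{-1})$. Define the following properties of $A$. * $SR_1$: for all $r\ge 1$ and $a_0,\dots,a_r\in A$ with $a_0A+\dots+a_rA=A$ there are $a_1',\dots,a_r'\in A$ with $a_i'\equiv a_i \pmod{a_0A}$ and $a_1'A+\dots+a_r'A=A$. The property $SR_{1\frac12}$: $A/\mathfrak q$ satisfies $SR_1$ for every nonzero ideal $\mathfrak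 q$ of $A$. * $GEN(t,r)$: for all $a,b\in A$ with $aA+bA=A$ there is $h\in a+bA$ such that $U/U^t$ can be generated by at most $r$ elements, where $U$ is the group of units of $A/hA$. * $EXP(t,\ell)$: for every nonzero $q\in A$ and $(a,b)\in W(qA)$ there are $a',c,d\in A$ and $u_i,f_i,g_i,b_i',d_i'\in A$ ($1\le i\le \ell$) such that (1) $a'\equiv a\pmod{bA}$; (2) $\begin{pmatrix}a'&b\\c&d\end{pmatrix}\in SL(2,A;qA)$; (3) $\begin{pmatrix}a'&b_i'\\c&d_i'\end{pmatrix}\in SL(2,A;qA)$ for all $i$; (4) $f_iI+g_i\begin{pmatrix}a'&b_i'\\c&d_i'\end{pmatrix}\in SL(2,A;qA)$ for all $i$; (5) $\prod_{i=1}^{\ell}(f_i+g_ia')^2\equiv (a')^t\pmod{cA}$; (6) $u_i$ is a unit of $A$ and $f_i+g_ia'\equiv u_i\pmod{b_i'A}$ for all $i$. * $UNIT(r,x)$: (1) for every nonzero $q\in A$ there is a unit $u\equiv 1\pmod{qA}$ with $u^4\ne 1$; and (2) there is a unit $u_0$ with $u_0^2\neq 1$ such that for every ideal $\mathfrak q$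 generated by at most $r$ elements and every $T\in SL(2,A;\mathfrak q)$ there are $E_1,\dots,E_x\in LU(2,\mathfrak q)$ with $H(u_0)^{-1}\,T\,H(u_0)=E_1\,T\,E_2E_3\cdots E_x$. * $CONJ(z)$: for every nonzero $q\in A$ there is a nonzero $q'\in A$ such that every element of $q'A$ is a sum of at most $z$ elements of $\mathcal M_{qA}$, where $\mathcal M_{\mathfrak q}$ is the set of $y\in\mathfrak q$ for which there are $w\in A$ with $w\equiv 1$ or $w\equiv-1\pmod{\mathfrak q}$ and units $u_1,u_2$ of $A$ with $1+y\,w\,u_1^2=u_2^2$. **Theorem.** Let $r,x,\ell,t,z$ be positive integers, let $A$ be an integral domain satisfying $SR_{1\frac12}$, $GEN(2,1)$, $GEN(t,r)$, $EXP(t,\ell)$, $UNIT(1,x)$ and $CONJ(z)$, and let $\mathfrak q$ be a nonzero ideal of $A$. Then $E^{\triangleleft}(2,A;\mathfrak q)$ is a normal subgroup of $SL(2,A;\mathfrak q)$, and the quotient group $SL(2,A;\mathfrak q)/E^{\triangleleft}(2,A;\mathfrak q)$ is finite, of order at most $t^r$. -/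

import Mathlib

namespace BoundedGen

section SpecialLinear

variable {A : Type*} [CommRing A]

/-- `SL(n, A; 𝔮)`: the matrices in `SL(n, A)` congruent to the identity modulo `𝔮`. -/
def SLCong (n : ℕ) (𝔮 : Ideal A) : Subgroup (Matrix.SpecialLinearGroup (Fin n) A) :=
  (Matrix.SpecialLinearGroup.map (n := Fin n) (Ideal.Quotient.mk 𝔮)).ker

theorem mem_SLCong_iff {n : ℕ} {𝔮 : Ideal A} {T : Matrix.SpecialLinearGroup (Fin n) A} :
    T ∈ SLCong n 𝔮 ↔ ∀ i j, (T : Matrix (Fin n) (Fin n) A) i j - (1 : Matrix (Fin n) (Fin n) A) i j ∈ 𝔮 := by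
  rw [SLCong, MonoidHom.mem_ker, Matrix.SpecialLinearGroup.ext_iff]
  refine forall_congr' fun i => forall_congr' fun j => ?_
  rw [← Ideal.Quotient.eq, Matrix.SpecialLinearGroup.map_apply_coe,
    Matrix.SpecialLinearGroup.coe_one]
  by_cases h : i = j
  · subst h; simp
  · simp [h]

/-- The matrix `M` (not a priori of determinant `1`) lies in `SL(n, A; 𝔮)`. -/
def InSLCong {n : ℕ} (𝔮 : Ideal A) (M : Matrix (Fin n) (Fin n) A) : Prop :=
  ∃ T ∈ SLCong n 𝔮, (T : Matrix (Fin n) (Fin n) A) = M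

/-- `LU(n, 𝔮)`: the elementary matrices `E_{i,j}(a)` with `i ≠ j` and `a ∈ 𝔮`. -/
def LU (n : ℕ) (𝔮 : Ideal A) : Set (Matrix.SpecialLinearGroup (Fin n) A) :=
  {E | ∃ (i j : Fin n) (h : i ≠ j), ∃ a ∈ 𝔮, E = Matrix.SpecialLinearGroup.transvection h a}

/-- `E(n, 𝔮)`: the subgroup generated by `LU(n, 𝔮)`; in particular `Elem n ⊤` is `E(n, A)`. -/
def Elem (n : ℕ) (𝔮 : Ideal A) : Subgroup (Matrix.SpecialLinearGroup (Fin n) A) :=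
  Subgroup.closure (LU n 𝔮)

/-- `LU^◁(n, A; 𝔮)`: the `E(n, A)`-conjugates of the elements of `LU(n, 𝔮)`. -/
def LUNormal (n : ℕ) (𝔮 : Ideal A) : Set (Matrix.SpecialLinearGroup (Fin n) A) :=
  {T | ∃ g ∈ Elem n (⊤ : Ideal A), ∃ E ∈ LU n 𝔮, T = g⁻¹ * E * g}

/-- `E^◁(n, A; 𝔮)`: the subgroup generated by `LU^◁(n, A; 𝔮)`. -/
def ElemNormal (n : ℕ) (𝔮 : Ideal A) : Subgroup (Matrix.SpecialLinearGroup (Fin n) A) :=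
  Subgroup.closure (LUNormal n 𝔮)

theorem LU_subset_SLCong (n : ℕ) (𝔮 : Ideal A) : LU n 𝔮 ⊆ SLCong n 𝔮 := by
  rintro _ ⟨i, j, h, a, ha, rfl⟩
  refine mem_SLCong_iff.2 fun k l => ?_
  rw [Matrix.SpecialLinearGroup.transvection_coe, Matrix.add_apply, add_sub_cancel_left,
    Matrix.single_apply]
  split_ifs
  · exact ha
  · exact 𝔮.zero_mem

theorem ElemNormal_le_SLCong (n : ℕ) (𝔮 : Ideal A) : ElemNormal n 𝔮 ≤ SLCong n 𝔮 := by
  refine (Subgroup.closure_le _).2 ?_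
  rintro _ ⟨g, -, E, hE, rfl⟩
  have hN : (SLCong n 𝔮).Normal := MonoidHom.normal_ker _
  simpa using hN.conj_mem E (LU_subset_SLCong n 𝔮 hE) g⁻¹

/-- `W(𝔮)`: the unimodular pairs congruent to `(1, 0)` modulo `𝔮`. -/
def W (𝔮 : Ideal A) : Set (A × A) :=
  {p | p.1 - 1 ∈ 𝔮 ∧ p.2 ∈ 𝔮 ∧ IsCoprime p.1 p.2}

/-- `H(u) = diag(u, u⁻¹)`. -/
def H (u : Aˣ) : Matrix.SpecialLinearGroup (Fin 2) A :=
  ⟨!![(u : A), 0; 0, ((u⁻¹ : Aˣ) : A)], by simp [Matrix.det_fin_two]⟩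

end SpecialLinear

/-- The group `G` can be generated by at most `r` elements. -/
def GeneratedByAtMost (G : Type*) [Group G] (r : ℕ) : Prop :=
  ∃ S : Finset G, S.card ≤ r ∧ Subgroup.closure (S : Set G) = ⊤

section Properties

variable (A : Type*) [CommRing A]

/-- Bass's stable range condition `SR_m`. -/
def SR (m : ℕ) : Prop :=
  ∀ (r : ℕ), m ≤ r → ∀ (a₀ : A) (a : Fin r → A),
    Ideal.span {a₀} ⊔ Ideal.span (Set.range a) = ⊤ →
    ∃ a' : Fin r → A, (∀ i, a' i - a i ∈ Ideal.span {a₀}) ∧ Ideal.span (Set.range a') = ⊤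

/-- The condition `SR_{1½}`: every quotient by a nonzero ideal satisfies `SR_1`. -/
def SROneHalf : Prop :=
  ∀ 𝔮 : Ideal A, 𝔮 ≠ ⊥ → SR (A ⧸ 𝔮) 1

/-- The few generators property `GEN(t, r)`: whenever `aA + bA = A`, there is `h ∈ a + bA` such
that `U / U ^ t` can be generated by at most `r` elements, where `U` is the group of units
of `A / hA`. -/
def GEN (t r : ℕ) : Prop :=
  ∀ a b : A, IsCoprime a b → ∃ h : A, h - a ∈ Ideal.span {b} ∧
    GeneratedByAtMost
      ((A ⧸ Ideal.span {h})ˣ ⧸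
        (powMonoidHom t : (A ⧸ Ideal.span {h})ˣ →* (A ⧸ Ideal.span {h})ˣ).range) r

/-- The exponent property `EXP(t, ℓ)`. -/
def EXP (t l : ℕ) : Prop :=
  ∀ q : A, q ≠ 0 → ∀ a b : A, (a, b) ∈ W (Ideal.span {q}) →
    ∃ (a' c d : A) (u f g b' d' : Fin l → A),
      a' - a ∈ Ideal.span {b} ∧
      InSLCong (Ideal.span {q}) !![a', b; c, d] ∧
      (∀ i, InSLCong (Ideal.span {q}) !![a', b' i; c, d' i]) ∧
      (∀ i, InSLCong (Ideal.span {q})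
        (f i • (1 : Matrix (Fin 2) (Fin 2) A) + g i • !![a', b' i; c, d' i])) ∧
      (∏ i, (f i + g i * a') ^ 2) - a' ^ t ∈ Ideal.span {c} ∧
      (∀ i, IsUnit (u i) ∧ f i + g i * a' - u i ∈ Ideal.span {b' i})

/-- The unit property `UNIT(r, x)`. The list `L` holds the factors `E₂, …, E_x`. -/
def UNIT (r x : ℕ) : Prop :=
  (∀ q : A, q ≠ 0 → ∃ u : Aˣ, (u : A) - 1 ∈ Ideal.span {q} ∧ u ^ 4 ≠ 1) ∧
  ∃ u₀ : Aˣ, u₀ ^ 2 ≠ 1 ∧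
    ∀ 𝔮 : Ideal A, (∃ S : Finset A, S.card ≤ r ∧ Ideal.span (S : Set A) = 𝔮) →
      ∀ T ∈ SLCong 2 𝔮,
        ∃ (E₁ : Matrix.SpecialLinearGroup (Fin 2) A)
          (L : List (Matrix.SpecialLinearGroup (Fin 2) A)),
          E₁ ∈ LU 2 𝔮 ∧ (∀ E ∈ L, E ∈ LU 2 𝔮) ∧ L.length + 1 = x ∧
            (H u₀)⁻¹ * T * H u₀ = E₁ * T * L.prod

variable {A} in
/-- The set `M_𝔮` of all `y ∈ 𝔮` for which `1 + y z u₁² = u₂²` for some `z ≡ ±1` modulo `𝔮` and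
some units `u₁`, `u₂`. -/
def conjSet (𝔮 : Ideal A) : Set A :=
  {y | y ∈ 𝔮 ∧ ∃ z : A, (z - 1 ∈ 𝔮 ∨ z + 1 ∈ 𝔮) ∧
    ∃ u₁ u₂ : Aˣ, 1 + y * z * (u₁ : A) ^ 2 = (u₂ : A) ^ 2}

/-- The conjugation property `CONJ(z)`: for every nonzero `q` there is a nonzero `q'` such that
every element of `q'A` is a sum of at most `z` elements of `M_{qA}`. -/
def CONJ (z : ℕ) : Prop :=
  ∀ q : A, q ≠ 0 → ∃ q' : A, q' ≠ 0 ∧ ∀ y ∈ Ideal.span {q'},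
    ∃ s : Multiset A, s.card ≤ z ∧ (∀ w ∈ s, w ∈ conjSet (Ideal.span {q})) ∧ s.sum = y

end Properties

end BoundedGen

/-!
Write `E^◁(𝔮)` for `E^◁(2, A; 𝔮)`, `SL(𝔮)` for `SL(2, A; 𝔮)`, and let `K` be the field of fractions
of `A`.

*Deep elements.* By the unit property, conjugation by `H(u₀)` changes an element of `SL(qA)` only by
factors in `E(2, qA)`. Hence a commutator of `g ∈ SL(2, K)` with `H(u₀)` also acts trivially on the
double cosets of `E^◁(qA)` in a sufficiently deep `SL(q'A)`, provided that the elementary factors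
that appear on the way are conjugated back into `E^◁` (`ActsTrivially.of_commutator`). The matrix
`E₁₂(k)` is such a commutator up to a factor `E₁₂(k₁)`, and the proviso concerns only `k₁` and one
more point of `K`. It holds at inverses of elements of `A`, and a unit that is `≡ 1` modulo the
numerator of `k` provides a choice of `k₁` for which both points are such inverses
(`actsTrivially_e12`). So all of `SL(2, K)` acts trivially on deep double cosets
(`actsTrivially`).

*Normality.* By stable range `1` of the proper quotients, every element of `SL(𝔮)` lies in a coset
of `E^◁(𝔮)` with an arbitrarily deep representative (`exists_ElemAux_mul_mem`). With the previous
fact this shows that `E^◁(𝔮)` is normal in `SL(𝔮)`, that the quotient is abelian with trivial action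
of `E(2, A)`, and that it does not see conjugation by `diag(u⁻¹, u)` on `SL(u²qA)`
(`DeepTrivial.normal`, `DeepTrivial.commutator_mem`, `DeepTrivial.diag_conj`).

*Mennicke symbols.* The class of a matrix is therefore a function `[b; a]` of its first row
`(a, b)`, and depends on `b` modulo `a` and on `a` modulo `b` only. Conjugation by diagonal matrices
gives `[u²b; a] = [u²; a] [b; a]`, and the transpose gives `[b; a] = [-b'; a]⁻¹` for an inverse `b'` of
`b` modulo `a`. By `GEN(2, 1)` one may assume that the units modulo `a` are cyclic modulo squares;
then these two rules force the symbol to be multiplicative in `b` (`IsMennickeHom.symb_mul_right`),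
and it is multiplicative in `a` as well (`IsMennickeHom.symb_mul_left`).

*Exponent.* Multiplicativity shows that `[c; f + g a'] = 1` for each of the factors in the exponent
property (`IsMennickeHom.symb_eq_one_of_linear`), so that the quotient has exponent dividing `t`
(`IsMennickeHom.pow_eq_one`).

*Order.* Finitely many symbols can be given a common first entry `a`, which `GEN(t, r)` allows to be
replaced by an `h` for which `U / Uᵗ` has at most `r` generators, `U` being the group of units
modulo `h`. The given symbols lie in the image of `U / Uᵗ`, which has at most `tʳ` elements
(`IsMennickeHom.card_image_le`).
-/

namespace BoundedGen

/-! ### Elementary matrices of size two -/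

section Matrices

variable {R : Type*} [CommRing R]

theorem sl2_ext {X Y : Matrix.SpecialLinearGroup (Fin 2) R} (h00 : X 0 0 = Y 0 0)
    (h01 : X 0 1 = Y 0 1) (h10 : X 1 0 = Y 1 0) (h11 : X 1 1 = Y 1 1) : X = Y := by
  ext i j
  fin_cases i <;> fin_cases j <;> assumption

theorem sl2_det (X : Matrix.SpecialLinearGroup (Fin 2) R) :
    X 0 0 * X 1 1 - X 0 1 * X 1 0 = 1 := by
  rw [← Matrix.det_fin_two, X.det_coe]

theorem sl2_mul_apply (X Y : Matrix.SpecialLinearGroup (Fin 2) R) (i j : Fin 2) :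
    (X * Y) i j = X i 0 * Y 0 j + X i 1 * Y 1 j := by
  simp [Matrix.mul_apply, Fin.sum_univ_two]

theorem sl2_inv_00 (X : Matrix.SpecialLinearGroup (Fin 2) R) : X⁻¹ 0 0 = X 1 1 := by
  simp [Matrix.SpecialLinearGroup.coe_inv, Matrix.adjugate_fin_two]

theorem sl2_inv_01 (X : Matrix.SpecialLinearGroup (Fin 2) R) : X⁻¹ 0 1 = -X 0 1 := by
  simp [Matrix.SpecialLinearGroup.coe_inv, Matrix.adjugate_fin_two]

theorem sl2_inv_10 (X : Matrix.SpecialLinearGroup (Fin 2) R) : X⁻¹ 1 0 = -X 1 0 := by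
  simp [Matrix.SpecialLinearGroup.coe_inv, Matrix.adjugate_fin_two]

theorem sl2_inv_11 (X : Matrix.SpecialLinearGroup (Fin 2) R) : X⁻¹ 1 1 = X 0 0 := by
  simp [Matrix.SpecialLinearGroup.coe_inv, Matrix.adjugate_fin_two]

/-- The matrix in `SL(2, R)` with prescribed entries. -/
def sl2 (a b c d : R) (h : a * d - b * c = 1) : Matrix.SpecialLinearGroup (Fin 2) R :=
  ⟨!![a, b; c, d], by rw [Matrix.det_fin_two_of]; exact h⟩

section

variable (a b c d : R) (h : a * d - b * c = 1)

@[simp] theorem sl2_00 : sl2 a b c d h 0 0 = a := rfl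
@[simp] theorem sl2_01 : sl2 a b c d h 0 1 = b := rfl
@[simp] theorem sl2_10 : sl2 a b c d h 1 0 = c := rfl
@[simp] theorem sl2_11 : sl2 a b c d h 1 1 = d := rfl

end

/-- The upper elementary matrix `E₁₂(a)`. -/
def e12 (a : R) : Matrix.SpecialLinearGroup (Fin 2) R := sl2 1 a 0 1 (by ring)

/-- The lower elementary matrix `E₂₁(a)`. -/
def e21 (a : R) : Matrix.SpecialLinearGroup (Fin 2) R := sl2 1 0 a 1 (by ring)

@[simp] theorem e12_00 (a : R) : e12 a 0 0 = 1 := rfl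
@[simp] theorem e12_01 (a : R) : e12 a 0 1 = a := rfl
@[simp] theorem e12_10 (a : R) : e12 a 1 0 = 0 := rfl
@[simp] theorem e12_11 (a : R) : e12 a 1 1 = 1 := rfl
@[simp] theorem e21_00 (a : R) : e21 a 0 0 = 1 := rfl
@[simp] theorem e21_01 (a : R) : e21 a 0 1 = 0 := rfl
@[simp] theorem e21_10 (a : R) : e21 a 1 0 = a := rfl
@[simp] theorem e21_11 (a : R) : e21 a 1 1 = 1 := rfl
@[simp] theorem H_00 (u : Rˣ) : H u 0 0 = u := rfl
@[simp] theorem H_01 (u : Rˣ) : H u 0 1 = 0 := rfl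
@[simp] theorem H_10 (u : Rˣ) : H u 1 0 = 0 := rfl
@[simp] theorem H_11 (u : Rˣ) : H u 1 1 = ((u⁻¹ : Rˣ) : R) := rfl

theorem e12_neg (a : R) : e12 (-a) = (e12 a)⁻¹ := by
  apply sl2_ext <;> simp [sl2_inv_00, sl2_inv_01, sl2_inv_10, sl2_inv_11]

theorem e21_neg (a : R) : e21 (-a) = (e21 a)⁻¹ := by
  apply sl2_ext <;> simp [sl2_inv_00, sl2_inv_01, sl2_inv_10, sl2_inv_11]

theorem e12_zero : e12 (0 : R) = 1 := sl2_ext rfl rfl rfl rfl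

theorem e12_add (a b : R) : e12 (a + b) = e12 a * e12 b := by
  apply sl2_ext <;> simp [sl2_mul_apply, add_comm]

theorem mem_LU_two {𝔮 : Ideal R} {E : Matrix.SpecialLinearGroup (Fin 2) R} :
    E ∈ LU 2 𝔮 ↔ ∃ a ∈ 𝔮, E = e12 a ∨ E = e21 a := by
  have h12 : ∀ (h : (0 : Fin 2) ≠ 1) (a : R),
      Matrix.SpecialLinearGroup.transvection h a = e12 a := fun h a => by
    apply sl2_ext <;> simp [Matrix.SpecialLinearGroup.transvection_coe]
  have h21 : ∀ (h : (1 : Fin 2) ≠ 0) (a : R),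
      Matrix.SpecialLinearGroup.transvection h a = e21 a := fun h a => by
    apply sl2_ext <;> simp [Matrix.SpecialLinearGroup.transvection_coe]
  constructor
  · rintro ⟨i, j, h, a, ha, rfl⟩
    refine ⟨a, ha, ?_⟩
    fin_cases i <;> fin_cases j
    · exact absurd rfl h
    · exact Or.inl (h12 _ a)
    · exact Or.inr (h21 _ a)
    · exact absurd rfl h
  · rintro ⟨a, ha, rfl | rfl⟩
    · exact ⟨0, 1, zero_ne_one, a, ha, (h12 _ a).symm⟩
    · exact ⟨1, 0, one_ne_zero, a, ha, (h21 _ a).symm⟩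

theorem mem_SLCong_two {𝔮 : Ideal R} {T : Matrix.SpecialLinearGroup (Fin 2) R} :
    T ∈ SLCong 2 𝔮 ↔ T 0 0 - 1 ∈ 𝔮 ∧ T 0 1 ∈ 𝔮 ∧ T 1 0 ∈ 𝔮 ∧ T 1 1 - 1 ∈ 𝔮 := by
  rw [mem_SLCong_iff]
  simp [Fin.forall_fin_two, and_assoc]

/-- A matrix whose first row is congruent to `(1, 0)` and whose lower left entry vanishes modulo
`𝔮` is congruent to the identity, as the determinant is `1`. -/
theorem mem_SLCong_two_of {𝔮 : Ideal R} {T : Matrix.SpecialLinearGroup (Fin 2) R}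
    (h00 : T 0 0 - 1 ∈ 𝔮) (h01 : T 0 1 ∈ 𝔮) (h10 : T 1 0 ∈ 𝔮) : T ∈ SLCong 2 𝔮 := by
  refine mem_SLCong_two.2 ⟨h00, h01, h10, ?_⟩
  have h : T 1 1 - 1 = T 0 1 * T 1 0 - T 1 1 * (T 0 0 - 1) := by
    linear_combination sl2_det T
  rw [h]
  exact 𝔮.sub_mem (𝔮.mul_mem_right _ h01) (𝔮.mul_mem_left _ h00)

instance SLCong_normal (n : ℕ) (𝔮 : Ideal R) : (SLCong n 𝔮).Normal := MonoidHom.normal_ker _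

theorem SLCong_mono {n : ℕ} {I J : Ideal R} (h : I ≤ J) : SLCong n I ≤ SLCong n J :=
  fun _ hT => mem_SLCong_iff.2 fun i j => h (mem_SLCong_iff.1 hT i j)

theorem LU_mono {n : ℕ} {I J : Ideal R} (h : I ≤ J) : LU n I ⊆ LU n J := by
  rintro _ ⟨i, j, hij, a, ha, rfl⟩
  exact ⟨i, j, hij, a, h ha, rfl⟩

theorem ElemNormal_mono {n : ℕ} {I J : Ideal R} (h : I ≤ J) :
    ElemNormal n I ≤ ElemNormal n J := by
  refine Subgroup.closure_mono ?_
  rintro _ ⟨g, hg, E, hE, rfl⟩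
  exact ⟨g, hg, E, LU_mono h hE, rfl⟩

theorem Elem_le_ElemNormal (n : ℕ) (𝔮 : Ideal R) : Elem n 𝔮 ≤ ElemNormal n 𝔮 :=
  Subgroup.closure_mono fun E hE => ⟨1, one_mem _, E, hE, by simp⟩

theorem ElemNormal_conj {n : ℕ} {𝔮 : Ideal R} {g T : Matrix.SpecialLinearGroup (Fin n) R}
    (hg : g ∈ Elem n (⊤ : Ideal R)) (hT : T ∈ ElemNormal n 𝔮) :
    g⁻¹ * T * g ∈ ElemNormal n 𝔮 := by
  induction hT using Subgroup.closure_induction with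
  | mem T hT =>
    obtain ⟨k, hk, E, hE, rfl⟩ := hT
    exact Subgroup.subset_closure ⟨k * g, mul_mem hk hg, E, hE, by group⟩
  | one => simp
  | mul X Y _ _ hX hY =>
    have h : g⁻¹ * (X * Y) * g = (g⁻¹ * X * g) * (g⁻¹ * Y * g) := by group
    rw [h]
    exact mul_mem hX hY
  | inv X _ hX =>
    have h : g⁻¹ * X⁻¹ * g = (g⁻¹ * X * g)⁻¹ := by group
    rw [h]
    exact inv_mem hX

theorem e12_mem_Elem {𝔮 : Ideal R} {a : R} (ha : a ∈ 𝔮) : e12 a ∈ Elem 2 𝔮 :=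
  Subgroup.subset_closure (mem_LU_two.2 ⟨a, ha, Or.inl rfl⟩)

theorem e21_mem_Elem {𝔮 : Ideal R} {a : R} (ha : a ∈ 𝔮) : e21 a ∈ Elem 2 𝔮 :=
  Subgroup.subset_closure (mem_LU_two.2 ⟨a, ha, Or.inr rfl⟩)

theorem e12_mem_ElemNormal {𝔮 : Ideal R} {a : R} (ha : a ∈ 𝔮) : e12 a ∈ ElemNormal 2 𝔮 :=
  Elem_le_ElemNormal _ _ (e12_mem_Elem ha)

theorem e21_mem_ElemNormal {𝔮 : Ideal R} {a : R} (ha : a ∈ 𝔮) : e21 a ∈ ElemNormal 2 𝔮 :=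
  Elem_le_ElemNormal _ _ (e21_mem_Elem ha)

/-- The Weyl element `E₁₂(1) E₂₁(-1) E₁₂(1)`. -/
def weyl : Matrix.SpecialLinearGroup (Fin 2) R := sl2 0 1 (-1) 0 (by ring)

theorem weyl_mem_Elem : (weyl : Matrix.SpecialLinearGroup (Fin 2) R) ∈ Elem 2 (⊤ : Ideal R) := by
  have h : (weyl : Matrix.SpecialLinearGroup (Fin 2) R) = e12 1 * e21 (-1) * e12 1 := by
    apply sl2_ext <;> simp [weyl, sl2_mul_apply]
  rw [h]
  exact mul_mem (mul_mem (e12_mem_Elem trivial) (e21_mem_Elem trivial)) (e12_mem_Elem trivial)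

/-- The group generated by `LU(2, 𝔮)` and the conjugates by `E₂₁(1)` of the upper elementary
matrices in it. These few conjugates suffice to reach deeper congruence subgroups, and they are
explicit enough to be followed under conjugation by diagonal matrices over the field of
fractions. -/
def ElemAux (𝔮 : Ideal R) : Subgroup (Matrix.SpecialLinearGroup (Fin 2) R) :=
  Subgroup.closure (LU 2 𝔮 ∪ {T | ∃ y ∈ 𝔮, T = e21 (-1) * e12 y * e21 1})

theorem ElemAux_le_ElemNormal (𝔮 : Ideal R) : ElemAux 𝔮 ≤ ElemNormal 2 𝔮 := by
  refine (Subgroup.closure_le _).2 ?_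
  rintro T (hT | ⟨y, hy, rfl⟩)
  · exact Elem_le_ElemNormal _ _ (Subgroup.subset_closure hT)
  · rw [e21_neg]
    exact ElemNormal_conj (e21_mem_Elem trivial) (e12_mem_ElemNormal hy)

theorem e12_mem_ElemAux {𝔮 : Ideal R} {a : R} (ha : a ∈ 𝔮) : e12 a ∈ ElemAux 𝔮 :=
  Subgroup.subset_closure (Or.inl (mem_LU_two.2 ⟨a, ha, Or.inl rfl⟩))

theorem e21_mem_ElemAux {𝔮 : Ideal R} {a : R} (ha : a ∈ 𝔮) : e21 a ∈ ElemAux 𝔮 :=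
  Subgroup.subset_closure (Or.inl (mem_LU_two.2 ⟨a, ha, Or.inr rfl⟩))

/-- If `a d ≡ 1` modulo `q` and `d ≡ 1` modulo `𝔮`, then `diag(d, a)` lifts modulo `q` to an
element of `ElemAux 𝔮`. -/
theorem exists_ElemAux_diag {𝔮 : Ideal R} {q a d : R} (had : q ∣ a * d - 1) (hd : d - 1 ∈ 𝔮) :
    ∃ n ∈ ElemAux 𝔮, q ∣ n 0 0 - d ∧ q ∣ n 0 1 ∧ q ∣ n 1 0 ∧ q ∣ n 1 1 - a := by
  obtain ⟨w, hw⟩ := had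
  refine ⟨e21 ((d - 1) * a) * (e21 (-1) * e12 (d - 1) * e21 1) * e12 (-((d - 1) * a)),
    mul_mem (mul_mem (e21_mem_ElemAux (𝔮.mul_mem_right _ hd))
      (Subgroup.subset_closure (Or.inr ⟨_, hd, rfl⟩)))
      (e12_mem_ElemAux (𝔮.neg_mem (𝔮.mul_mem_right _ hd))), ?_, ?_, ?_, ?_⟩ <;>
    simp only [sl2_mul_apply, e12_00, e12_01, e12_10, e12_11, e21_00, e21_01, e21_10, e21_11]
  · exact ⟨0, by ring⟩
  · exact ⟨-(d - 1) * w, by linear_combination -(d - 1) * hw⟩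
  · exact ⟨(d - 1) * w, by linear_combination (d - 1) * hw⟩
  · exact ⟨w * (d - 2 - (d - 1) ^ 2 * a), by
      linear_combination (d - 2 - (d - 1) ^ 2 * a) * hw⟩

/-- Stable range `1` for `R / qR`: a coprime pair `(a, b)` can be changed to one with `b` coprime to
`q`. -/
theorem SR.exists_isCoprime_add_mul {q a b : R} (hq : SR (R ⧸ Ideal.span {q}) 1)
    (h : IsCoprime a b) : ∃ s, IsCoprime q (b + s * a) := by
  obtain ⟨b', hb', hspan⟩ := hq 1 le_rfl (Ideal.Quotient.mk _ a)
    (fun _ => Ideal.Quotient.mk _ b) (by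
      rw [Ideal.eq_top_iff_one, Set.range_const, ← Ideal.span_union, Set.singleton_union,
        Ideal.mem_span_pair]
      obtain ⟨x, y, hxy⟩ := h
      exact ⟨Ideal.Quotient.mk _ x, Ideal.Quotient.mk _ y, by
        rw [← map_mul, ← map_mul, ← map_add, hxy, map_one]⟩)
  obtain ⟨s, hs⟩ := Ideal.mem_span_singleton'.1 (hb' 0)
  obtain ⟨s, rfl⟩ := Ideal.Quotient.mk_surjective s
  have hr : Set.range b' = {b' 0} := by
    ext z
    simp [Fin.exists_fin_one, eq_comm]
  rw [hr, Ideal.eq_top_iff_one, Ideal.mem_span_singleton'] at hspan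
  obtain ⟨α, hα⟩ := hspan
  obtain ⟨α, rfl⟩ := Ideal.Quotient.mk_surjective α
  have h' : b' 0 = Ideal.Quotient.mk _ (b + s * a) := by
    rw [map_add, map_mul, hs]; ring
  rw [h', ← map_mul, ← map_one (Ideal.Quotient.mk (Ideal.span {q})), Ideal.Quotient.eq,
    Ideal.mem_span_singleton] at hα
  obtain ⟨k, hk⟩ := hα
  exact ⟨s, -k, α, by linear_combination hk⟩

/-- If `R / qR` satisfies `SR₁`, then `SL(2, R; 𝔮)` is the product of `SL(2, R; qR)` and
`E^◁(2, R; 𝔮)`; the factor in the latter can be taken in `ElemAux 𝔮`. -/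
theorem exists_ElemAux_mul_mem {q : R} (hq : SR (R ⧸ Ideal.span {q}) 1) {𝔮 : Ideal R}
    {T : Matrix.SpecialLinearGroup (Fin 2) R} (hT : T ∈ SLCong 2 𝔮) :
    ∃ n ∈ ElemAux 𝔮, T * n ∈ SLCong 2 (Ideal.span {q}) := by
  have hAux : ∀ {n}, n ∈ ElemAux 𝔮 → n ∈ SLCong 2 𝔮 := fun hn =>
    ElemNormal_le_SLCong _ _ (ElemAux_le_ElemNormal _ hn)
  -- make the upper left entry a unit modulo `q`
  obtain ⟨n₁, hn₁, α, hα⟩ : ∃ n ∈ ElemAux 𝔮, ∃ α, q ∣ (T * n) 0 0 * α - 1 := by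
    have hc : IsCoprime (T 0 1 ^ 2) (T 0 0) :=
      IsCoprime.pow_left ⟨-T 1 0, T 1 1, by linear_combination sl2_det T⟩
    obtain ⟨s, k, α, hα⟩ := SR.exists_isCoprime_add_mul hq hc
    refine ⟨e21 (s * T 0 1), e21_mem_ElemAux (𝔮.mul_mem_left _ (mem_SLCong_two.1 hT).2.1),
      α, -k, ?_⟩
    simp only [sl2_mul_apply, e21_00, e21_10]
    linear_combination hα
  set T₁ := T * n₁ with hT₁
  have hT₁m : T₁ ∈ SLCong 2 𝔮 := mul_mem hT (hAux hn₁)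
  -- clear the upper right entry modulo `q`
  set n₂ : Matrix.SpecialLinearGroup (Fin 2) R := e12 (-(α * T₁ 0 1)) with hn₂
  have hn₂m : n₂ ∈ ElemAux 𝔮 :=
    e12_mem_ElemAux (𝔮.neg_mem (𝔮.mul_mem_left _ (mem_SLCong_two.1 hT₁m).2.1))
  set T₂ := T₁ * n₂ with hT₂
  have hT₂m : T₂ ∈ SLCong 2 𝔮 := mul_mem hT₁m (hAux hn₂m)
  have h01 : q ∣ T₂ 0 1 := by
    obtain ⟨w, hw⟩ := hα
    refine ⟨-w * T₁ 0 1, ?_⟩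
    simp only [hT₂, hn₂, sl2_mul_apply, e12_01, e12_11]
    linear_combination -T₁ 0 1 * hw
  obtain ⟨w, hw⟩ := h01
  have hdet₂ := sl2_det T₂
  -- clear the lower left entry modulo `q`
  set n₃ : Matrix.SpecialLinearGroup (Fin 2) R := e21 (-(T₂ 1 0 * T₂ 0 0)) with hn₃
  have hn₃m : n₃ ∈ ElemAux 𝔮 :=
    e21_mem_ElemAux (𝔮.neg_mem (𝔮.mul_mem_right _ (mem_SLCong_two.1 hT₂m).2.2.1))
  set T₃ := T₂ * n₃ with hT₃
  have hT₃m : T₃ ∈ SLCong 2 𝔮 := mul_mem hT₂m (hAux hn₃m)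
  have h01 : q ∣ T₃ 0 1 := ⟨w, by simp only [hT₃, hn₃, sl2_mul_apply, e21_01, e21_11, hw]; ring⟩
  have h10 : q ∣ T₃ 1 0 := by
    refine ⟨-T₂ 1 0 * T₂ 1 0 * w, ?_⟩
    simp only [hT₃, hn₃, sl2_mul_apply, e21_00, e21_10]
    linear_combination -T₂ 1 0 * hdet₂ - T₂ 1 0 * T₂ 1 0 * hw
  obtain ⟨w₁, hw₁⟩ := h01
  obtain ⟨w₂, hw₂⟩ := h10
  have hdet₃ := sl2_det T₃
  -- kill the diagonal
  obtain ⟨n₄, hn₄m, ⟨v₁, hv₁⟩, ⟨v₂, hv₂⟩, ⟨v₃, hv₃⟩, ⟨v₄, hv₄⟩⟩ :=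
    exists_ElemAux_diag (𝔮 := 𝔮) (q := q) (a := T₃ 0 0) (d := T₃ 1 1)
      ⟨w₁ * T₃ 1 0, by linear_combination hdet₃ + T₃ 1 0 * hw₁⟩ (mem_SLCong_two.1 hT₃m).2.2.2
  refine ⟨n₁ * n₂ * n₃ * n₄, mul_mem (mul_mem (mul_mem hn₁ hn₂m) hn₃m) hn₄m, ?_⟩
  have h : T * (n₁ * n₂ * n₃ * n₄) = T₃ * n₄ := by
    simp only [hT₃, hT₂, hT₁, mul_assoc]
  rw [h]
  refine mem_SLCong_two_of ?_ ?_ ?_ <;>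
    simp only [sl2_mul_apply, Ideal.mem_span_singleton]
  · exact ⟨T₃ 0 0 * v₁ + w₁ * T₃ 1 0 + w₁ * n₄ 1 0, by
      linear_combination T₃ 0 0 * hv₁ + hdet₃ + (T₃ 1 0 + n₄ 1 0) * hw₁⟩
  · exact ⟨T₃ 0 0 * v₂ + w₁ * n₄ 1 1, by linear_combination T₃ 0 0 * hv₂ + n₄ 1 1 * hw₁⟩
  · exact ⟨w₂ * n₄ 0 0 + T₃ 1 1 * v₃, by linear_combination n₄ 0 0 * hw₂ + T₃ 1 1 * hv₃⟩

end Matrices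

/-! ### Elements acting trivially on deep double cosets -/

section Trivial

variable {A : Type*} [CommRing A] (K : Type*) [Field K] [Algebra A K]

/-- The inclusion of `SL(2, A)` into `SL(2, K)`. -/
abbrev toK : Matrix.SpecialLinearGroup (Fin 2) A →* Matrix.SpecialLinearGroup (Fin 2) K :=
  Matrix.SpecialLinearGroup.map (algebraMap A K)

@[simp] theorem toK_apply (T : Matrix.SpecialLinearGroup (Fin 2) A) (i j : Fin 2) :
    toK K T i j = algebraMap A K (T i j) := rfl

theorem toK_e12 (a : A) : toK K (e12 a) = e12 (algebraMap A K a) := by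
  apply sl2_ext <;> simp

theorem toK_e21 (a : A) : toK K (e21 a) = e21 (algebraMap A K a) := by
  apply sl2_ext <;> simp

variable {K}

/-- `g` acts trivially, by conjugation, on the double cosets of `E^◁(2, A; qA)`, provided that one
restricts to a congruence subgroup that is deep enough (depending on `q`). -/
def ActsTrivially (A : Type*) [CommRing A] {K : Type*} [Field K] [Algebra A K]
    (g : Matrix.SpecialLinearGroup (Fin 2) K) : Prop :=
  ∀ q : A, q ≠ 0 → ∃ q' : A, q' ≠ 0 ∧ ∀ Z ∈ SLCong 2 (Ideal.span {q'}),
    ∃ n ∈ ElemNormal 2 (Ideal.span {q}), ∃ n' ∈ ElemNormal 2 (Ideal.span {q}),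
      g⁻¹ * toK K Z * g = toK K (n * Z * n')

/-- Conjugation by `h` maps the elementary matrices of a sufficiently deep level into
`E^◁(2, A; qA)`. -/
def ElemConj (A : Type*) [CommRing A] {K : Type*} [Field K] [Algebra A K]
    (h : Matrix.SpecialLinearGroup (Fin 2) K) : Prop :=
  ∀ q : A, q ≠ 0 → ∃ q' : A, q' ≠ 0 ∧ ∀ E ∈ LU 2 (Ideal.span {q'}),
    ∃ n ∈ ElemNormal 2 (Ideal.span {q}), h⁻¹ * toK K E * h = toK K n

theorem span_mul_le_left (p q : A) : Ideal.span {p * q} ≤ Ideal.span {p} :=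
  Ideal.span_singleton_le_span_singleton.2 (dvd_mul_right p q)

theorem span_mul_le_right (p q : A) : Ideal.span {p * q} ≤ Ideal.span {q} :=
  Ideal.span_singleton_le_span_singleton.2 (dvd_mul_left q p)

theorem ActsTrivially.one : ActsTrivially A (1 : Matrix.SpecialLinearGroup (Fin 2) K) :=
  fun q hq => ⟨q, hq, fun Z _ => ⟨1, one_mem _, 1, one_mem _, by simp⟩⟩

/-- Applied to the elements of a deep `E^◁(2, A; q'A)` themselves, the hypothesis on `h` says that
conjugation by `h` maps them into `E^◁(2, A; qA)`. This makes the property multiplicative. -/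
theorem ActsTrivially.mul [IsDomain A] {g h : Matrix.SpecialLinearGroup (Fin 2) K}
    (hg : ActsTrivially A g) (hh : ActsTrivially A h) : ActsTrivially A (g * h) := by
  intro q hq
  obtain ⟨q₁, hq₁, h₁⟩ := hh q hq
  have hqq : q₁ * q ≠ 0 := mul_ne_zero hq₁ hq
  obtain ⟨q₂, hq₂, h₂⟩ := hg (q₁ * q) hqq
  have key : ∀ n ∈ ElemNormal 2 (Ideal.span {q₁ * q}),
      ∃ m ∈ ElemNormal 2 (Ideal.span {q}), h⁻¹ * toK K n * h = toK K m := by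
    intro n hn
    obtain ⟨m, hm, m', hm', e⟩ :=
      h₁ n (SLCong_mono (span_mul_le_left _ _) (ElemNormal_le_SLCong _ _ hn))
    exact ⟨_, mul_mem (mul_mem hm (ElemNormal_mono (span_mul_le_right _ _) hn)) hm', e⟩
  refine ⟨q₁ * q₂, mul_ne_zero hq₁ hq₂, fun Z hZ => ?_⟩
  obtain ⟨n, hn, n', hn', e⟩ := h₂ Z (SLCong_mono (span_mul_le_right _ _) hZ)
  obtain ⟨m, hm, m', hm', e'⟩ := h₁ Z (SLCong_mono (span_mul_le_left _ _) hZ)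
  obtain ⟨k, hk, ek⟩ := key n hn
  obtain ⟨k', hk', ek'⟩ := key n' hn'
  refine ⟨k * m, mul_mem hk hm, m' * k', mul_mem hm' hk', ?_⟩
  calc (g * h)⁻¹ * toK K Z * (g * h) = h⁻¹ * (g⁻¹ * toK K Z * g) * h := by group
    _ = (h⁻¹ * toK K n * h) * (h⁻¹ * toK K Z * h) * (h⁻¹ * toK K n' * h) := by
        rw [e]; simp only [map_mul]; group
    _ = toK K (k * m * Z * (m' * k')) := by
        rw [ek, ek', e']; simp only [map_mul, mul_assoc]

theorem ActsTrivially.conj_toK {g : Matrix.SpecialLinearGroup (Fin 2) K} (hg : ActsTrivially A g)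
    {w : Matrix.SpecialLinearGroup (Fin 2) A} (hw : w ∈ Elem 2 (⊤ : Ideal A)) :
    ActsTrivially A ((toK K w)⁻¹ * g * toK K w) := by
  intro q hq
  obtain ⟨q', hq', h⟩ := hg q hq
  refine ⟨q', hq', fun Z hZ => ?_⟩
  obtain ⟨n, hn, n', hn', e⟩ := h (w * Z * w⁻¹) ((SLCong_normal _ _).conj_mem _ hZ _)
  refine ⟨_, ElemNormal_conj hw hn, _, ElemNormal_conj hw hn', ?_⟩
  calc ((toK K w)⁻¹ * g * toK K w)⁻¹ * toK K Z * ((toK K w)⁻¹ * g * toK K w)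
      = (toK K w)⁻¹ * (g⁻¹ * toK K (w * Z * w⁻¹) * g) * toK K w := by
        simp only [map_mul, map_inv]; group
    _ = _ := by rw [e]; simp only [map_mul, map_inv]; group

/-- An element of `SL(2, K)` conjugates a deep congruence subgroup of `SL(2, A)` into a given
one. -/
theorem exists_conj_mem_SLCong [IsDomain A] [IsFractionRing A K]
    (g : Matrix.SpecialLinearGroup (Fin 2) K) {q : A} (hq : q ≠ 0) : ∃ q' : A, q' ≠ 0 ∧ ∀ Z ∈ SLCong 2 (Ideal.span {q'}),
      ∃ Z₁ ∈ SLCong 2 (Ideal.span {q}), g * toK K Z * g⁻¹ = toK K Z₁ := by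
  obtain ⟨⟨d, hd⟩, hint⟩ := IsLocalization.exist_integer_multiples_of_finite
    (nonZeroDivisors A) (fun p : Fin 2 × Fin 2 => g p.1 p.2)
  have hd0 : d ≠ 0 := nonZeroDivisors.ne_zero hd
  have hinj : Function.Injective (algebraMap A K) := IsFractionRing.injective A K
  choose y hy using hint
  have h00 := hy (0, 0)
  have h01 := hy (0, 1)
  have h10 := hy (1, 0)
  have h11 := hy (1, 1)
  simp only [Algebra.smul_def] at h00 h01 h10 h11
  generalize y (0, 0) = p at h00
  generalize y (0, 1) = p' at h01
  generalize y (1, 0) = p'' at h10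
  generalize y (1, 1) = p''' at h11
  refine ⟨d * d * q, mul_ne_zero (mul_ne_zero hd0 hd0) hq, fun Z hZ => ?_⟩
  have hdet := sl2_det g
  obtain ⟨m0, m1, m2, m3⟩ := mem_SLCong_two.1 hZ
  rw [Ideal.mem_span_singleton] at m0 m1 m2 m3
  obtain ⟨x0, hx0⟩ := m0
  obtain ⟨x1, hx1⟩ := m1
  obtain ⟨x2, hx2⟩ := m2
  obtain ⟨x3, hx3⟩ := m3
  have i0 := congrArg (algebraMap A K) hx0
  have i1 := congrArg (algebraMap A K) hx1
  have i2 := congrArg (algebraMap A K) hx2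
  have i3 := congrArg (algebraMap A K) hx3
  simp only [map_sub, map_mul, map_one] at i0 i1 i2 i3
  -- the entries of `(g Z g⁻¹ - 1) / q`
  set c0 := (p * x0 + p' * x2) * p''' - (p * x1 + p' * x3) * p'' with hc0
  set c1 := -(p * x0 + p' * x2) * p' + (p * x1 + p' * x3) * p with hc1
  set c2 := (p'' * x0 + p''' * x2) * p''' - (p'' * x1 + p''' * x3) * p'' with hc2
  set c3 := -(p'' * x0 + p''' * x2) * p' + (p'' * x1 + p''' * x3) * p with hc3
  have E0 : (g * toK K Z * g⁻¹) 0 0 = algebraMap A K (1 + q * c0) := by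
    simp only [hc0, sl2_mul_apply, sl2_inv_00, sl2_inv_10, toK_apply, map_add, map_sub, map_mul,
      map_one, h00, h01, h10, h11]
    linear_combination hdet + g 0 0 * g 1 1 * i0 - g 0 0 * g 1 0 * i1 + g 0 1 * g 1 1 * i2
      - g 0 1 * g 1 0 * i3
  have E1 : (g * toK K Z * g⁻¹) 0 1 = algebraMap A K (q * c1) := by
    simp only [hc1, sl2_mul_apply, sl2_inv_01, sl2_inv_11, toK_apply, map_add, map_neg, map_mul,
      h00, h01]
    linear_combination -g 0 0 * g 0 1 * i0 + g 0 0 * g 0 0 * i1 - g 0 1 * g 0 1 * i2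
      + g 0 1 * g 0 0 * i3
  have E2 : (g * toK K Z * g⁻¹) 1 0 = algebraMap A K (q * c2) := by
    simp only [hc2, sl2_mul_apply, sl2_inv_00, sl2_inv_10, toK_apply, map_add, map_sub, map_mul,
      h10, h11]
    linear_combination g 1 0 * g 1 1 * i0 - g 1 0 * g 1 0 * i1 + g 1 1 * g 1 1 * i2
      - g 1 1 * g 1 0 * i3
  have E3 : (g * toK K Z * g⁻¹) 1 1 = algebraMap A K (1 + q * c3) := by
    simp only [hc3, sl2_mul_apply, sl2_inv_01, sl2_inv_11, toK_apply, map_add, map_neg, map_mul,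
      map_one, h00, h01, h10, h11]
    linear_combination hdet - g 1 0 * g 0 1 * i0 + g 1 0 * g 0 0 * i1 - g 1 1 * g 0 1 * i2
      + g 1 1 * g 0 0 * i3
  have hdet' : (1 + q * c0) * (1 + q * c3) - q * c1 * (q * c2) = 1 := by
    apply hinj
    rw [map_sub, map_mul, map_mul, ← E0, ← E1, ← E2, ← E3, map_one]
    exact sl2_det _
  refine ⟨sl2 (1 + q * c0) (q * c1) (q * c2) (1 + q * c3) hdet',
    mem_SLCong_two_of ?_ ?_ ?_, sl2_ext E0 E1 E2 E3⟩ <;> rw [Ideal.mem_span_singleton]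
  · exact ⟨c0, by rw [sl2_00]; ring⟩
  · exact ⟨c1, by rw [sl2_01]⟩
  · exact ⟨c2, by rw [sl2_10]⟩

theorem ElemConj.one : ElemConj A (1 : Matrix.SpecialLinearGroup (Fin 2) K) :=
  fun q hq => ⟨q, hq, fun E hE =>
    ⟨E, Elem_le_ElemNormal _ _ (Subgroup.subset_closure hE), by simp⟩⟩

theorem ElemConj.exists_of_mem_Elem {h : Matrix.SpecialLinearGroup (Fin 2) K} {q q' : A}
    (hq : ∀ E ∈ LU 2 (Ideal.span {q'}),
      ∃ n ∈ ElemNormal 2 (Ideal.span {q}), h⁻¹ * toK K E * h = toK K n)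
    {e : Matrix.SpecialLinearGroup (Fin 2) A} (he : e ∈ Elem 2 (Ideal.span {q'})) :
    ∃ n ∈ ElemNormal 2 (Ideal.span {q}), h⁻¹ * toK K e * h = toK K n := by
  induction he using Subgroup.closure_induction with
  | mem E hE => exact hq E hE
  | one => exact ⟨1, one_mem _, by simp⟩
  | mul X Y _ _ hX hY =>
    obtain ⟨m, hm, e⟩ := hX
    obtain ⟨m', hm', e'⟩ := hY
    exact ⟨m * m', mul_mem hm hm', by rw [map_mul, map_mul, ← e, ← e']; group⟩
  | inv X _ hX =>
    obtain ⟨m, hm, e⟩ := hX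
    exact ⟨m⁻¹, inv_mem hm, by rw [map_inv, map_inv, ← e]; group⟩

/-- The only part of the unit property that is needed: conjugation by `H(u)` changes an element of
`SL(2, A; qA)` by factors in `E(2, A; qA)` only. -/
def UnitActs (u : Aˣ) : Prop :=
  ∀ q : A, ∀ T ∈ SLCong 2 (Ideal.span {q}), ∃ e ∈ Elem 2 (Ideal.span {q}),
    ∃ e' ∈ Elem 2 (Ideal.span {q}), (H u)⁻¹ * T * H u = e * T * e'

theorem UnitActs.inv {u : Aˣ} (hu : UnitActs u) {q : A}
    {T : Matrix.SpecialLinearGroup (Fin 2) A} (hT : T ∈ SLCong 2 (Ideal.span {q})) :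
    ∃ e ∈ Elem 2 (Ideal.span {q}), ∃ e' ∈ Elem 2 (Ideal.span {q}),
      H u * T * (H u)⁻¹ = e * T * e' := by
  obtain ⟨e, he, e', he', h⟩ := hu q (H u * T * (H u)⁻¹) ((SLCong_normal _ _).conj_mem _ hT _)
  refine ⟨e⁻¹, inv_mem he, e'⁻¹, inv_mem he', ?_⟩
  have h' : T = e * (H u * T * (H u)⁻¹) * e' := by
    rw [← h]; group
  calc H u * T * (H u)⁻¹ = e⁻¹ * (e * (H u * T * (H u)⁻¹) * e') * e'⁻¹ := by group
    _ = e⁻¹ * T * e'⁻¹ := by rw [← h']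

/-- The commutator of `g⁻¹` and `H(u)`, followed by an element `h` that is already known to act
trivially, acts trivially, as soon as the elementary factors that `H(u)` and `H(u)⁻¹` introduce
are moved into `E^◁` by the rest of the word. -/
theorem ActsTrivially.of_commutator [IsDomain A] [IsFractionRing A K] {u : Aˣ} (hu : UnitActs u)
    {g h : Matrix.SpecialLinearGroup (Fin 2) K} (h₁ : ElemConj A (g * (toK K (H u))⁻¹ * h))
    (h₂ : ElemConj A h) (h₃ : ActsTrivially A h) :
    ActsTrivially A (g⁻¹ * toK K (H u) * g * (toK K (H u))⁻¹ * h) := by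
  intro q hq
  obtain ⟨q₁, hq₁, H₁⟩ := h₁ q hq
  obtain ⟨q₂, hq₂, H₂⟩ := h₂ q hq
  obtain ⟨q₃, hq₃, H₃⟩ := h₃ q hq
  obtain ⟨q₄, hq₄, H₄⟩ := exists_conj_mem_SLCong (A := A) g hq₁
  refine ⟨q₂ * (q₃ * q₄), mul_ne_zero hq₂ (mul_ne_zero hq₃ hq₄), fun Z hZ => ?_⟩
  have hZ' := SLCong_mono (span_mul_le_right _ _) hZ
  obtain ⟨Z₁, hZ₁, eZ₁⟩ := H₄ Z (SLCong_mono (span_mul_le_right _ _) hZ')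
  obtain ⟨e₁, he₁, e₁', he₁', E₁⟩ := hu q₁ Z₁ hZ₁
  obtain ⟨e₂, he₂, e₂', he₂', E₂⟩ := hu.inv (SLCong_mono (span_mul_le_left _ _) hZ)
  obtain ⟨m, hm, m', hm', E₃⟩ := H₃ Z (SLCong_mono (span_mul_le_left _ _) hZ')
  obtain ⟨n₁, hn₁, F₁⟩ := ElemConj.exists_of_mem_Elem H₁ he₁
  obtain ⟨n₁', hn₁', F₁'⟩ := ElemConj.exists_of_mem_Elem H₁ he₁'
  obtain ⟨n₂, hn₂, F₂⟩ := ElemConj.exists_of_mem_Elem H₂ he₂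
  obtain ⟨n₂', hn₂', F₂'⟩ := ElemConj.exists_of_mem_Elem H₂ he₂'
  refine ⟨n₁ * n₂ * m, mul_mem (mul_mem hn₁ hn₂) hm, m' * n₂' * n₁',
    mul_mem (mul_mem hm' hn₂') hn₁', ?_⟩
  have E₁K := congrArg (toK K) E₁
  have E₂K := congrArg (toK K) E₂
  simp only [map_mul, map_inv] at E₁K E₂K
  generalize toK K (H u) = η at *
  set k := g * η⁻¹ * h with hk
  calc (g⁻¹ * η * g * η⁻¹ * h)⁻¹ * toK K Z * (g⁻¹ * η * g * η⁻¹ * h)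
      = k⁻¹ * (η⁻¹ * (g * toK K Z * g⁻¹) * η) * k := by rw [hk]; group
    _ = (k⁻¹ * toK K e₁ * k) * (k⁻¹ * (g * toK K Z * g⁻¹) * k) * (k⁻¹ * toK K e₁' * k) := by
        rw [eZ₁, E₁K]; group
    _ = toK K n₁ * (h⁻¹ * (η * toK K Z * η⁻¹) * h) * toK K n₁' := by
        rw [F₁, F₁', hk]; group
    _ = toK K n₁ * ((h⁻¹ * toK K e₂ * h) * (h⁻¹ * toK K Z * h) * (h⁻¹ * toK K e₂' * h))
          * toK K n₁' := by rw [E₂K]; group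
    _ = _ := by rw [F₂, F₂', E₃]; simp only [map_mul, mul_assoc]

theorem e12_conj_e21 {r : K} (hr : r ≠ 0) (s : K) :
    e12 (-r⁻¹) * e21 (r ^ 2 * s) * e12 r⁻¹ = e21 (-r) * e12 (-s) * e21 r := by
  apply sl2_ext <;> simp [sl2_mul_apply] <;> field_simp <;> ring

theorem e21_conj_e12 {r : K} (hr : r ≠ 0) (s : K) :
    e21 (-r⁻¹) * e12 (r ^ 2 * s) * e21 r⁻¹ = e12 (-r) * e21 (-s) * e12 r := by
  apply sl2_ext <;> simp [sl2_mul_apply] <;> field_simp <;> ring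

/-- The lower elementary matrices become, after conjugation by `E₁₂(1/r)`, the conjugates by
`E₂₁(r)` of upper ones; since `r` lies in `A`, these belong to `E^◁`. -/
theorem elemConj_e12_inv [IsDomain A] [IsFractionRing A K] {r : A} (hr : r ≠ 0) :
    ElemConj A (e12 (algebraMap A K r)⁻¹) := by
  have hr' : algebraMap A K r ≠ 0 := by simpa using hr
  intro q hq
  refine ⟨r ^ 2 * q, mul_ne_zero (pow_ne_zero 2 hr) hq, fun E hE => ?_⟩
  obtain ⟨y, hy, rfl | rfl⟩ := mem_LU_two.1 hE
  · refine ⟨e12 y, e12_mem_ElemNormal (span_mul_le_right _ _ hy), ?_⟩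
    rw [toK_e12, ← e12_neg, ← e12_add, ← e12_add]
    congr 1
    ring
  · obtain ⟨s, rfl⟩ := Ideal.mem_span_singleton'.1 hy
    refine ⟨(e21 r)⁻¹ * e12 (-(s * q)) * e21 r, ElemNormal_conj (e21_mem_Elem trivial)
      (e12_mem_ElemNormal (Ideal.neg_mem_iff _ |>.2 (Ideal.mul_mem_left _ _
        (Ideal.mem_span_singleton_self q)))), ?_⟩
    have h : s * (r ^ 2 * q) = r ^ 2 * (s * q) := by ring
    rw [← e12_neg, ← e21_neg, h]
    simp only [map_mul, toK_e12, toK_e21, map_neg, map_pow]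
    exact e12_conj_e21 hr' _

theorem ElemConj.toK_H_mul {h : Matrix.SpecialLinearGroup (Fin 2) K} (hh : ElemConj A h)
    (u : Aˣ) : ElemConj A ((toK K (H u))⁻¹ * h) := by
  intro q hq
  obtain ⟨q', hq', hE⟩ := hh q hq
  refine ⟨q', hq', fun E hE' => ?_⟩
  have hmem : H u * E * (H u)⁻¹ ∈ LU 2 (Ideal.span {q'}) := by
    obtain ⟨y, hy, rfl | rfl⟩ := mem_LU_two.1 hE'
    · refine mem_LU_two.2 ⟨u ^ 2 * y, Ideal.mul_mem_left _ _ hy, Or.inl ?_⟩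
      apply sl2_ext <;>
        simp [sl2_mul_apply, sl2_inv_00, sl2_inv_01, sl2_inv_10, sl2_inv_11]
      ring
    · refine mem_LU_two.2 ⟨((u⁻¹ : Aˣ) : A) ^ 2 * y, Ideal.mul_mem_left _ _ hy, Or.inr ?_⟩
      apply sl2_ext <;>
        simp [sl2_mul_apply, sl2_inv_00, sl2_inv_01, sl2_inv_10, sl2_inv_11]
      ring
  obtain ⟨n, hn, e⟩ := hE _ hmem
  refine ⟨n, hn, ?_⟩
  rw [← e, map_mul, map_mul, map_inv]
  group

variable [IsDomain A] [IsFractionRing A K]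

/-- The upper elementary matrix `E₁₂(k)` is the commutator of `H(u)` with an upper elementary
matrix, times `E₁₂(k₁)`. The elementary factors which `H(u)` introduces are controlled at the two
points `k₁` and `(u² k - k₁) / (u² - 1)` of the projective line: it is enough that these are zero or
inverses of elements of `A`. -/
theorem actsTrivially_e12_of {u : Aˣ} (hu : UnitActs u) (hu2 : u ^ 2 ≠ 1) {k k₁ : K}
    (h₁ : ElemConj A (e12 k₁)) (h₂ : ActsTrivially A (e12 k₁)) {r : A} (hr : r ≠ 0)
    (hk : (algebraMap A K u ^ 2 * k - k₁) * algebraMap A K r = algebraMap A K u ^ 2 - 1) :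
    ActsTrivially A (e12 k) := by
  have hinj : Function.Injective (algebraMap A K) := IsFractionRing.injective A K
  set v := algebraMap A K u with hv
  have hv0 : v ≠ 0 := by simp [hv]
  have hv1 : v ^ 2 - 1 ≠ 0 := by
    rw [hv, ← map_pow, ← map_one (algebraMap A K), sub_ne_zero]
    exact fun h => hu2 (Units.ext (by simpa using hinj h))
  have hr' : algebraMap A K r ≠ 0 := by simpa using hr
  set g : Matrix.SpecialLinearGroup (Fin 2) K := e12 ((k - k₁) / (v ^ 2 - 1)) with hg
  have e₁ : g * (toK K (H u))⁻¹ * e12 k₁ = (toK K (H u))⁻¹ * e12 (algebraMap A K r)⁻¹ := by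
    have h : g * (toK K (H u))⁻¹ = (toK K (H u))⁻¹ * e12 (v ^ 2 * ((k - k₁) / (v ^ 2 - 1))) := by
      apply sl2_ext <;>
        simp [hg, sl2_mul_apply, sl2_inv_00, sl2_inv_01, sl2_inv_10, sl2_inv_11, ← hv]
      field_simp
    rw [h, mul_assoc, ← e12_add]
    congr 2
    refine eq_inv_of_mul_eq_one_left ?_
    field_simp
    linear_combination hk
  have e₂ : g⁻¹ * toK K (H u) * g * (toK K (H u))⁻¹ * e12 k₁ = e12 k := by
    have h : toK K (H u) * g * (toK K (H u))⁻¹ = e12 (v ^ 2 * ((k - k₁) / (v ^ 2 - 1))) := by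
      apply sl2_ext <;>
        simp [hg, sl2_mul_apply, sl2_inv_00, sl2_inv_01, sl2_inv_10, sl2_inv_11, ← hv, hv0]
      ring
    rw [mul_assoc g⁻¹, mul_assoc g⁻¹, h, hg, ← e12_neg, ← e12_add, ← e12_add]
    congr 1
    field_simp
    ring
  rw [← e₂]
  refine ActsTrivially.of_commutator hu ?_ h₁ h₂
  rw [e₁]
  exact (elemConj_e12_inv hr).toK_H_mul u

theorem actsTrivially_e12_inv {u : Aˣ} (hu : UnitActs u) (hu2 : u ^ 2 ≠ 1) {r : A} (hr : r ≠ 0) :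
    ActsTrivially A (e12 (algebraMap A K r)⁻¹) := by
  have hr' : algebraMap A K r ≠ 0 := by simpa using hr
  have hvv : algebraMap A K u * algebraMap A K ((u⁻¹ : Aˣ) : A) = 1 := by
    rw [← map_mul, Units.mul_inv, map_one]
  have hu1 : (u : A) ^ 2 - 1 ≠ 0 :=
    sub_ne_zero.2 fun h => hu2 (Units.ext (by simpa using h))
  refine actsTrivially_e12_of (k₁ := 0) hu hu2 (by rw [e12_zero]; exact ElemConj.one)
    (by rw [e12_zero]; exact ActsTrivially.one)
    (r := ((u⁻¹ : Aˣ) : A) ^ 2 * r * ((u : A) ^ 2 - 1))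
    (mul_ne_zero (mul_ne_zero (pow_ne_zero 2 u⁻¹.ne_zero) hr) hu1) ?_
  simp only [map_mul, map_sub, map_pow, map_one, sub_zero]
  field_simp
  linear_combination (algebraMap A K u ^ 2 - 1) *
    (algebraMap A K u * algebraMap A K ((u⁻¹ : Aˣ) : A) + 1) * hvv

/-- For `k = p / s`, the two points that matter can be given unit numerators with the help of a
unit that is congruent to `1` modulo `p`. -/
theorem actsTrivially_e12 {u : Aˣ} (hu : UnitActs u) (hu2 : u ^ 2 ≠ 1)
    (hunits : ∀ q : A, q ≠ 0 → ∃ v : Aˣ, (v : A) - 1 ∈ Ideal.span {q} ∧ v ≠ 1) (k : K) :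
    ActsTrivially A (e12 k) := by
  obtain ⟨p, s, hs, rfl⟩ := IsFractionRing.div_surjective (A := A) k
  have hs0 : s ≠ 0 := nonZeroDivisors.ne_zero hs
  rcases eq_or_ne p 0 with rfl | hp
  · rw [map_zero, zero_div, e12_zero]
    exact ActsTrivially.one
  obtain ⟨v, hv, hv1⟩ := hunits p hp
  obtain ⟨w, hw⟩ := Ideal.mem_span_singleton'.1 hv
  have hw0 : w ≠ 0 := by
    rintro rfl
    rw [zero_mul, eq_comm, sub_eq_zero] at hw
    exact hv1 (Units.ext hw)
  have hu1 : (u : A) ^ 2 - 1 ≠ 0 :=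
    sub_ne_zero.2 fun h => hu2 (Units.ext (by simpa using h))
  have huu : (u : A) * ((u⁻¹ : Aˣ) : A) = 1 := Units.mul_inv u
  have hvv : (v : A) * ((v⁻¹ : Aˣ) : A) = 1 := Units.mul_inv v
  -- `k₁ = 1 / (s m)`, where `u² p m = 1 - v`, so that `u² k - k₁ = -v / (s m)`
  set m : A := -(((u⁻¹ : Aˣ) : A) ^ 2 * w) with hm
  have hm0 : m ≠ 0 := neg_ne_zero.2 (mul_ne_zero (pow_ne_zero 2 u⁻¹.ne_zero) hw0)
  have hpm : (u : A) ^ 2 * p * m = 1 - v := by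
    rw [hm]
    linear_combination -hw - p * w * ((u : A) * ((u⁻¹ : Aˣ) : A) + 1) * huu
  have hsm : s * m ≠ 0 := mul_ne_zero hs0 hm0
  refine actsTrivially_e12_of (k₁ := (algebraMap A K (s * m))⁻¹) hu hu2 (elemConj_e12_inv hsm)
    (actsTrivially_e12_inv hu hu2 hsm)
    (r := -(((v⁻¹ : Aˣ) : A) * (s * m) * ((u : A) ^ 2 - 1)))
    (neg_ne_zero.2 (mul_ne_zero (mul_ne_zero v⁻¹.ne_zero hsm) hu1)) ?_
  have hs' : algebraMap A K s ≠ 0 := by simpa using hs0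
  have hm' : algebraMap A K m ≠ 0 := by simpa using hm0
  have hpm' := congrArg (algebraMap A K) hpm
  have hvv' := congrArg (algebraMap A K) hvv
  simp only [map_mul, map_sub, map_pow, map_one, map_neg] at hpm' hvv' ⊢
  field_simp
  linear_combination (algebraMap A K u ^ 2 - 1) * (hvv' - algebraMap A K ((v⁻¹ : Aˣ) : A) * hpm')

theorem actsTrivially_e21 {u : Aˣ} (hu : UnitActs u) (hu2 : u ^ 2 ≠ 1)
    (hunits : ∀ q : A, q ≠ 0 → ∃ v : Aˣ, (v : A) - 1 ∈ Ideal.span {q} ∧ v ≠ 1) (k : K) :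
    ActsTrivially A (e21 k) := by
  have h : e21 k = (toK K (weyl (R := A)))⁻¹ * e12 (-k) * toK K (weyl (R := A)) := by
    apply sl2_ext <;>
      simp [sl2_mul_apply, sl2_inv_00, sl2_inv_01, sl2_inv_10, sl2_inv_11, weyl]
  rw [h]
  exact (actsTrivially_e12 hu hu2 hunits (-k)).conj_toK weyl_mem_Elem

/-- All of `SL(2, K)` acts trivially on deep double cosets. -/
theorem actsTrivially {u : Aˣ} (hu : UnitActs u) (hu2 : u ^ 2 ≠ 1)
    (hunits : ∀ q : A, q ≠ 0 → ∃ v : Aˣ, (v : A) - 1 ∈ Ideal.span {q} ∧ v ≠ 1)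
    (g : Matrix.SpecialLinearGroup (Fin 2) K) : ActsTrivially A g := by
  have key : ∀ g : Matrix.SpecialLinearGroup (Fin 2) K, g 1 0 ≠ 0 → ActsTrivially A g := by
    intro g hg
    have h : g = e12 ((g 0 0 - 1) / g 1 0) * e21 (g 1 0) *
        e12 ((g 1 1 - 1) / g 1 0) := by
      have hdet := sl2_det g
      apply sl2_ext <;> simp [sl2_mul_apply] <;> field_simp
      · ring
      · linear_combination -hdet
      · ring
    rw [h]
    exact ((actsTrivially_e12 hu hu2 hunits _).mul (actsTrivially_e21 hu hu2 hunits _)).mul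
      (actsTrivially_e12 hu hu2 hunits _)
  by_cases hg : g 1 0 = 0
  · have h : g = e21 (-1) * (e21 1 * g) := by
      rw [e21_neg]; group
    rw [h]
    refine (actsTrivially_e21 hu hu2 hunits _).mul (key _ ?_)
    have hdet := sl2_det g
    rw [hg, mul_zero, sub_zero] at hdet
    simp only [sl2_mul_apply, e21_10, e21_11, hg, one_mul, add_zero]
    exact left_ne_zero_of_mul_eq_one hdet
  · exact key g hg

end Trivial

/-! ### Normality, and triviality of the action on the quotient -/

section Normality

variable {A : Type*} [CommRing A] [IsDomain A]

/-- The hypotheses under which the quotients `SL(2, A; 𝔮) / E^◁(2, A; 𝔮)` are studied. -/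
structure DeepTrivial (A : Type*) [CommRing A] [IsDomain A] : Prop where
  /-- Proper quotients have stable range `1`. -/
  sr : SROneHalf A
  /-- Conjugation by elements of `SL(2, K)` is trivial on deep double cosets. -/
  acts : ∀ g : Matrix.SpecialLinearGroup (Fin 2) (FractionRing A), ActsTrivially A g

theorem toK_injective : Function.Injective (toK (A := A) (FractionRing A)) := by
  intro X Y h
  have hinj := IsFractionRing.injective A (FractionRing A)
  apply sl2_ext <;> apply hinj
  · exact congrArg (fun Z : Matrix.SpecialLinearGroup (Fin 2) _ => Z 0 0) h
  · exact congrArg (fun Z : Matrix.SpecialLinearGroup (Fin 2) _ => Z 0 1) h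
  · exact congrArg (fun Z : Matrix.SpecialLinearGroup (Fin 2) _ => Z 1 0) h
  · exact congrArg (fun Z : Matrix.SpecialLinearGroup (Fin 2) _ => Z 1 1) h

namespace DeepTrivial

theorem sr_span (hA : DeepTrivial A) {q : A} (hq : q ≠ 0) : SR (A ⧸ Ideal.span {q}) 1 :=
  hA.sr _ (by rwa [Ne, Ideal.span_singleton_eq_bot])

theorem conj (hA : DeepTrivial A) (g : Matrix.SpecialLinearGroup (Fin 2) A) {q : A}
    (hq : q ≠ 0) : ∃ q' : A, q' ≠ 0 ∧ ∀ Z ∈ SLCong 2 (Ideal.span {q'}),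
      ∃ n ∈ ElemNormal 2 (Ideal.span {q}), ∃ n' ∈ ElemNormal 2 (Ideal.span {q}),
        g⁻¹ * Z * g = n * Z * n' := by
  obtain ⟨q', hq', h⟩ := hA.acts (toK _ g) q hq
  refine ⟨q', hq', fun Z hZ => ?_⟩
  obtain ⟨n, hn, n', hn', e⟩ := h Z hZ
  refine ⟨n, hn, n', hn', toK_injective ?_⟩
  rw [← e]
  simp only [map_mul, map_inv]

theorem exists_mul_mem (hA : DeepTrivial A) {q : A} (hq : q ≠ 0) {𝔮 : Ideal A}
    {T : Matrix.SpecialLinearGroup (Fin 2) A} (hT : T ∈ SLCong 2 𝔮) :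
    ∃ n ∈ ElemNormal 2 𝔮, T * n ∈ SLCong 2 (Ideal.span {q}) := by
  obtain ⟨n, hn, h⟩ := exists_ElemAux_mul_mem (hA.sr_span hq) hT
  exact ⟨n, ElemAux_le_ElemNormal _ hn, h⟩

/-- Some `E^◁(2, A; q₁A)` is contained in `T E^◁(2, A; 𝔮) T⁻¹`. An element `n` of `E^◁(2, A; 𝔮)`
changes `T`, moved to a deep level without changing the coset `T E^◁(2, A; 𝔮)`, only by factors in
`E^◁(2, A; q₁A)`, so that `n` lies in `T E^◁(2, A; 𝔮) T⁻¹` too. -/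
theorem normal (hA : DeepTrivial A) {𝔮 : Ideal A} (h𝔮 : 𝔮 ≠ ⊥)
    {T n : Matrix.SpecialLinearGroup (Fin 2) A} (hT : T ∈ SLCong 2 𝔮)
    (hn : n ∈ ElemNormal 2 𝔮) : T⁻¹ * n * T ∈ ElemNormal 2 𝔮 := by
  obtain ⟨q₀, hq₀, hq₀0⟩ := Submodule.exists_mem_ne_zero_of_ne_bot h𝔮
  have hle : Ideal.span {q₀} ≤ 𝔮 := (Ideal.span_singleton_le_iff_mem _).2 hq₀
  obtain ⟨q₁, hq₁, h₁⟩ := hA.conj T hq₀0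
  have hTm : ∀ m ∈ ElemNormal 2 (Ideal.span {q₁ * q₀}), T⁻¹ * m * T ∈ ElemNormal 2 𝔮 := by
    intro m hm
    obtain ⟨k, hk, k', hk', e⟩ :=
      h₁ m (SLCong_mono (span_mul_le_left _ _) (ElemNormal_le_SLCong _ _ hm))
    rw [e]
    exact mul_mem (mul_mem (ElemNormal_mono hle hk)
      (ElemNormal_mono ((span_mul_le_right _ _).trans hle) hm)) (ElemNormal_mono hle hk')
  obtain ⟨q₂, hq₂, h₂⟩ := hA.conj n (mul_ne_zero hq₁ hq₀0)
  obtain ⟨n₀, hn₀, hZ⟩ := hA.exists_mul_mem hq₂ hT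
  obtain ⟨m, hm, m', hm', e⟩ := h₂ _ hZ
  have hm'' : m' ∈ ElemNormal 2 𝔮 := ElemNormal_mono ((span_mul_le_right _ _).trans hle) hm'
  have h : T⁻¹ * n * T = n₀ * (n * m'⁻¹) * n₀⁻¹ * (T⁻¹ * m⁻¹ * T) := by
    have e' : m' = (T * n₀)⁻¹ * m⁻¹ * (n⁻¹ * (T * n₀) * n) := by rw [e]; group
    rw [e']
    group
  rw [h]
  exact mul_mem (mul_mem (mul_mem hn₀ (mul_mem hn (inv_mem hm''))) (inv_mem hn₀))
    (hTm _ (inv_mem hm))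

/-- Every element of `SL(2, A)` that normalizes `E^◁(2, A; 𝔮)` acts trivially on
`SL(2, A; 𝔮) / E^◁(2, A; 𝔮)`. -/
theorem commutator_mem (hA : DeepTrivial A) {𝔮 : Ideal A} (h𝔮 : 𝔮 ≠ ⊥)
    {T g : Matrix.SpecialLinearGroup (Fin 2) A} (hT : T ∈ SLCong 2 𝔮)
    (hg : ∀ n ∈ ElemNormal 2 𝔮, g⁻¹ * n * g ∈ ElemNormal 2 𝔮) :
    T⁻¹ * (g⁻¹ * T * g) ∈ ElemNormal 2 𝔮 := by
  obtain ⟨q₀, hq₀, hq₀0⟩ := Submodule.exists_mem_ne_zero_of_ne_bot h𝔮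
  have hle : Ideal.span {q₀} ≤ 𝔮 := (Ideal.span_singleton_le_iff_mem _).2 hq₀
  obtain ⟨q₁, hq₁, h₁⟩ := hA.conj g hq₀0
  obtain ⟨n₀, hn₀, hZ⟩ := hA.exists_mul_mem hq₁ hT
  obtain ⟨m, hm, m', hm', e⟩ := h₁ _ hZ
  have h : T⁻¹ * (g⁻¹ * T * g) = (T⁻¹ * m * T) * n₀ * m' * (g⁻¹ * n₀⁻¹ * g) := by
    have e' : m = (g⁻¹ * (T * n₀) * g) * m'⁻¹ * (T * n₀)⁻¹ := by rw [e]; group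
    rw [e']
    group
  rw [h]
  exact mul_mem (mul_mem (mul_mem (hA.normal h𝔮 hT (ElemNormal_mono hle hm)) hn₀)
    (ElemNormal_mono hle hm')) (hg _ (inv_mem hn₀))

/-- Conjugation by `diag(u⁻¹, u)` does not change the double coset of a matrix that is congruent to
the identity modulo `u² q`: a deep level is reached through elements of `ElemAux`, and these stay in
`E^◁(2, A; qA)`. -/
theorem diag_conj (hA : DeepTrivial A) {u q : A} (hu : u ≠ 0) (hq : q ≠ 0)
    {T T' : Matrix.SpecialLinearGroup (Fin 2) A} (hT : T ∈ SLCong 2 (Ideal.span {u ^ 2 * q}))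
    (h00 : T' 0 0 = T 0 0) (h01 : T' 0 1 = u ^ 2 * T 0 1) (h10 : u ^ 2 * T' 1 0 = T 1 0)
    (h11 : T' 1 1 = T 1 1) : ∃ n ∈ ElemNormal 2 (Ideal.span {q}),
      ∃ n' ∈ ElemNormal 2 (Ideal.span {q}), T' = n * T * n' := by
  set v := algebraMap A (FractionRing A) u with hv
  have hv0 : v ≠ 0 := by simpa [hv] using hu
  set D : Matrix.SpecialLinearGroup (Fin 2) (FractionRing A) :=
    sl2 v⁻¹ 0 0 v (by field_simp; ring) with hD
  have he12 : ∀ y, D⁻¹ * e12 y * D = e12 (v ^ 2 * y) := fun y => by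
    apply sl2_ext <;>
      simp [sl2_mul_apply, sl2_inv_00, sl2_inv_01, sl2_inv_10, sl2_inv_11, hD, hv0]
    ring
  have he21 : ∀ y, D⁻¹ * e21 (v ^ 2 * y) * D = e21 y := fun y => by
    apply sl2_ext <;>
      simp [sl2_mul_apply, sl2_inv_00, sl2_inv_01, sl2_inv_10, sl2_inv_11, hD, hv0]
    field_simp
  have hAux : ∀ n ∈ ElemAux (Ideal.span {u ^ 2 * q}), ∃ m ∈ ElemNormal 2 (Ideal.span {q}),
      D⁻¹ * toK _ n * D = toK _ m := by
    intro n hn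
    induction hn using Subgroup.closure_induction with
    | mem n hn =>
      rcases hn with hn | ⟨y, hy, rfl⟩
      · obtain ⟨y, hy, rfl | rfl⟩ := mem_LU_two.1 hn
        · refine ⟨e12 (u ^ 2 * y),
            e12_mem_ElemNormal (Ideal.mul_mem_left _ _ (span_mul_le_right _ _ hy)), ?_⟩
          rw [toK_e12, he12, toK_e12, map_mul, map_pow]
        · obtain ⟨s, rfl⟩ := Ideal.mem_span_singleton'.1 hy
          refine ⟨e21 (s * q),
            e21_mem_ElemNormal (Ideal.mul_mem_left _ _ (Ideal.mem_span_singleton_self q)), ?_⟩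
          have h : s * (u ^ 2 * q) = u ^ 2 * (s * q) := by ring
          rw [toK_e21, toK_e21, h, map_mul, map_pow, he21]
      · obtain ⟨s, rfl⟩ := Ideal.mem_span_singleton'.1 hy
        refine ⟨(e12 (u ^ 2))⁻¹ * e21 (-(s * q)) * e12 (u ^ 2),
          ElemNormal_conj (e12_mem_Elem trivial) (e21_mem_ElemNormal
            ((Ideal.neg_mem_iff _).2 (Ideal.mul_mem_left _ _ (Ideal.mem_span_singleton_self q)))),
          ?_⟩
        have h : s * (u ^ 2 * q) = u ^ 2 * (s * q) := by ring
        have h1 : (1 : FractionRing A) = v ^ 2 * (v ^ 2)⁻¹ := by field_simp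
        have h2 : (-1 : FractionRing A) = v ^ 2 * (-(v ^ 2)⁻¹) := by field_simp
        have hc : D⁻¹ * toK _ (e21 (-1) * e12 (s * (u ^ 2 * q)) * e21 1) * D
            = e21 (-(v ^ 2)⁻¹) * e12 ((v ^ 2) ^ 2 * algebraMap A _ (s * q)) * e21 (v ^ 2)⁻¹ := by
          have e1 := he21 (-(v ^ 2)⁻¹)
          have e2 := he12 (algebraMap A _ (s * (u ^ 2 * q)))
          have e3 := he21 (v ^ 2)⁻¹
          rw [← h2] at e1
          rw [← h1] at e3
          have e4 : v ^ 2 * algebraMap A _ (s * (u ^ 2 * q))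
              = (v ^ 2) ^ 2 * algebraMap A (FractionRing A) (s * q) := by
            rw [h, map_mul, map_pow, ← hv]; ring
          rw [← e4, ← e1, ← e2, ← e3, map_mul, map_mul, toK_e21, toK_e21, toK_e12, map_neg, map_one]
          group
        rw [hc, e21_conj_e12 (pow_ne_zero 2 hv0), ← e12_neg]
        simp only [map_mul, toK_e12, toK_e21, map_neg, map_pow, hv]
    | one => exact ⟨1, one_mem _, by simp⟩
    | mul X Y _ _ hX hY =>
      obtain ⟨m, hm, e⟩ := hX
      obtain ⟨m', hm', e'⟩ := hY
      exact ⟨m * m', mul_mem hm hm', by rw [map_mul, map_mul, ← e, ← e']; group⟩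
    | inv X _ hX =>
      obtain ⟨m, hm, e⟩ := hX
      exact ⟨m⁻¹, inv_mem hm, by rw [map_inv, map_inv, ← e]; group⟩
  obtain ⟨q', hq', h⟩ := hA.acts D q hq
  obtain ⟨n, hn, hZ⟩ := exists_ElemAux_mul_mem (hA.sr_span hq') hT
  obtain ⟨m, hm, m', hm', e⟩ := h _ hZ
  obtain ⟨k, hk, e'⟩ := hAux n hn
  have hn' : n ∈ ElemNormal 2 (Ideal.span {q}) :=
    ElemNormal_mono (span_mul_le_right _ _) (ElemAux_le_ElemNormal _ hn)
  refine ⟨m, hm, n * m' * k⁻¹, mul_mem (mul_mem hn' hm') (inv_mem hk), toK_injective ?_⟩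
  have hT' : toK _ T' = D⁻¹ * toK _ T * D := by
    have i01 := congrArg (algebraMap A (FractionRing A)) h01
    have i10 := congrArg (algebraMap A (FractionRing A)) h10
    simp only [map_mul, map_pow, ← hv] at i01 i10
    apply sl2_ext <;>
      simp only [sl2_mul_apply, sl2_inv_00, sl2_inv_01, sl2_inv_10, sl2_inv_11, hD, sl2_00, sl2_01,
        sl2_10, sl2_11, toK_apply, h00, h11, i01, ← i10] <;> field_simp <;> ring
  calc toK _ T' = (D⁻¹ * toK _ (T * n) * D) * (D⁻¹ * toK _ n * D)⁻¹ := by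
        rw [hT', map_mul]; group
    _ = toK _ (m * T * (n * m' * k⁻¹)) := by
        rw [e, e']; simp only [map_mul, map_inv, mul_assoc]

end DeepTrivial

/-- The unit property makes all of `SL(2, K)` act trivially on deep double cosets. -/
theorem DeepTrivial.of_unit {x : ℕ} (hSR : SROneHalf A) (hUNIT : UNIT A 1 x) : DeepTrivial A := by
  obtain ⟨h₁, u, hu2, hu⟩ := hUNIT
  refine ⟨hSR, actsTrivially (u := u) ?_ hu2 ?_⟩
  · intro q T hT
    obtain ⟨E, L, hE, hL, -, e⟩ := hu (Ideal.span {q}) ⟨{q}, by simp, by simp⟩ T hT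
    exact ⟨E, Subgroup.subset_closure hE, L.prod,
      Subgroup.list_prod_mem _ fun E hE => Subgroup.subset_closure (hL E hE), e⟩
  · intro q hq
    obtain ⟨v, hv, hv4⟩ := h₁ q hq
    exact ⟨v, hv, fun h => hv4 (by rw [h, one_pow])⟩

end Normality

/-! ### Mennicke symbols -/

section Mennicke

variable {A : Type*} [CommRing A] {q : A} {C : Type*} [CommGroup C]

/-- The pair `(a, b)` is the first row of a matrix in `SL(2, A; qA)`. -/
structure IsRow (q a b : A) : Prop where
  dvd_sub_one : q ∣ a - 1
  dvd : q ∣ b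
  coprime : IsCoprime a b

/-- A homomorphism from `SL(2, A; qA)` to an abelian group which factors through the coinvariants
of `E(2, A)` on `SL(2, A; qA) / E^◁(2, A; qA)`, and which does not see conjugation by
`diag(u⁻¹, u)` on `SL(2, A; u²qA)`. -/
structure IsMennickeHom (q : A) (φ : SLCong 2 (Ideal.span {q}) →* C) : Prop where
  ker : ∀ T : SLCong 2 (Ideal.span {q}), T.1 ∈ ElemNormal 2 (Ideal.span {q}) → φ T = 1
  conj : ∀ T T' : SLCong 2 (Ideal.span {q}), ∀ g ∈ Elem 2 (⊤ : Ideal A),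
    T'.1 = g⁻¹ * T.1 * g → φ T' = φ T
  diag : ∀ u : A, u ≠ 0 → ∀ T T' : SLCong 2 (Ideal.span {q}),
    T.1 ∈ SLCong 2 (Ideal.span {u ^ 2 * q}) → T'.1 0 0 = T.1 0 0 → T'.1 0 1 = u ^ 2 * T.1 0 1 →
      u ^ 2 * T'.1 1 0 = T.1 1 0 → T'.1 1 1 = T.1 1 1 → φ T' = φ T

open Classical in
/-- The value of `φ` at a matrix in `SL(2, A; qA)` with first row `(a, b)`, and `1` if there is no
such matrix. -/
noncomputable def symb (φ : SLCong 2 (Ideal.span {q}) →* C) (a b : A) : C :=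
  if h : ∃ T : SLCong 2 (Ideal.span {q}), T.1 0 0 = a ∧ T.1 0 1 = b then φ h.choose else 1

theorem mem_SLCong_span {T : Matrix.SpecialLinearGroup (Fin 2) A} :
    T ∈ SLCong 2 (Ideal.span {q}) ↔
      q ∣ T 0 0 - 1 ∧ q ∣ T 0 1 ∧ q ∣ T 1 0 ∧ q ∣ T 1 1 - 1 := by
  simp only [mem_SLCong_two, Ideal.mem_span_singleton]

theorem isRow_of_mem (T : SLCong 2 (Ideal.span {q})) : IsRow q (T.1 0 0) (T.1 0 1) :=
  ⟨(mem_SLCong_span.1 T.2).1, (mem_SLCong_span.1 T.2).2.1,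
    T.1 1 1, -T.1 1 0, by linear_combination sl2_det T.1⟩

theorem IsRow.exists_mem {a b : A} (h : IsRow q a b) :
    ∃ T : SLCong 2 (Ideal.span {q}), T.1 0 0 = a ∧ T.1 0 1 = b := by
  obtain ⟨x, y, hxy⟩ := h.coprime
  refine ⟨⟨sl2 a b (y * (a - 1)) (x + y * b) (by linear_combination hxy),
    mem_SLCong_two_of ?_ ?_ ?_⟩, rfl, rfl⟩ <;> rw [Ideal.mem_span_singleton]
  · exact h.dvd_sub_one
  · exact h.dvd
  · exact h.dvd_sub_one.mul_left y

theorem IsRow.congr_right {a b b' : A} (h : IsRow q a b) (hb' : q ∣ b') (hd : a ∣ b' - b) :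
    IsRow q a b' := by
  refine ⟨h.dvd_sub_one, hb', ?_⟩
  obtain ⟨k, hk⟩ := hd
  rw [show b' = b + a * k by linear_combination hk]
  exact h.coprime.add_mul_left_right k

theorem IsRow.congr_left {a a' b : A} (h : IsRow q a b) (hd : b ∣ a' - a) : IsRow q a' b := by
  obtain ⟨k, hk⟩ := hd
  refine ⟨?_, h.dvd, ?_⟩
  · rw [show a' - 1 = b * k + (a - 1) by linear_combination hk]
    exact dvd_add (h.dvd.mul_right k) h.dvd_sub_one
  · rw [show a' = a + b * k by linear_combination hk]
    exact h.coprime.add_mul_left_left k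

theorem IsRow.one {b : A} (hb : q ∣ b) : IsRow q 1 b := ⟨by simp, hb, isCoprime_one_left⟩

theorem IsRow.mul_left {a a' b : A} (h : IsRow q a b) (h' : IsRow q a' b) :
    IsRow q (a * a') b := by
  refine ⟨?_, h.dvd, h.coprime.mul_left h'.coprime⟩
  rw [show a * a' - 1 = a * (a' - 1) + (a - 1) by ring]
  exact dvd_add (h'.dvd_sub_one.mul_left a) h.dvd_sub_one

theorem IsRow.mul_right {a b b' : A} (h : IsRow q a b) (h' : IsRow q a b') :
    IsRow q a (b * b') :=
  ⟨h.dvd_sub_one, h.dvd.mul_right b', h.coprime.mul_right h'.coprime⟩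

/-- `β (1 - h)` is a representative of `β` modulo `h` which is divisible by `q`. -/
theorem isRow_mul_one_sub {h β : A} (hh : q ∣ h - 1) (hβ : IsCoprime h β) :
    IsRow q h (β * (1 - h)) := by
  refine ⟨hh, ((dvd_sub_comm).1 hh).mul_left β, hβ.mul_right ⟨1, 1, by ring⟩⟩

variable {φ : SLCong 2 (Ideal.span {q}) →* C}

namespace IsMennickeHom

theorem eq_mul (hφ : IsMennickeHom q φ) {T T' : SLCong 2 (Ideal.span {q})}
    {n n' : Matrix.SpecialLinearGroup (Fin 2) A} (hn : n ∈ ElemNormal 2 (Ideal.span {q}))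
    (hn' : n' ∈ ElemNormal 2 (Ideal.span {q})) (h : T'.1 = n * T.1 * n') : φ T' = φ T := by
  have h' : T' = ⟨n, ElemNormal_le_SLCong _ _ hn⟩ * T * ⟨n', ElemNormal_le_SLCong _ _ hn'⟩ :=
    Subtype.ext h
  rw [h', map_mul, map_mul, hφ.ker ⟨n, _⟩ hn, hφ.ker ⟨n', _⟩ hn', one_mul, mul_one]

/-- The value of `φ` depends on the first row only, since two matrices with the same first row
differ by a lower elementary matrix on the left. -/
theorem eq_symb (hφ : IsMennickeHom q φ) (T : SLCong 2 (Ideal.span {q})) {a b : A}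
    (ha : T.1 0 0 = a) (hb : T.1 0 1 = b) : φ T = symb φ a b := by
  have h : ∃ T : SLCong 2 (Ideal.span {q}), T.1 0 0 = a ∧ T.1 0 1 = b := ⟨T, ha, hb⟩
  rw [symb, dif_pos h]
  obtain ⟨ha', hb'⟩ := h.choose_spec
  set S := h.choose
  have hM : (T * S⁻¹).1 = e21 ((T * S⁻¹).1 1 0) := by
    have d := sl2_det S.1
    rw [ha', hb'] at d
    apply sl2_ext <;> simp only [Subgroup.coe_mul, Subgroup.coe_inv, sl2_mul_apply, sl2_inv_00,
      sl2_inv_01, sl2_inv_10, sl2_inv_11, e21_00, e21_01, e21_10, e21_11, ha, hb, ha', hb']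
    · linear_combination d
    · ring
    · have d' := sl2_det T.1
      rw [ha, hb] at d'
      linear_combination d'
  refine hφ.eq_mul (n := (T * S⁻¹).1) (n' := 1) ?_ (one_mem _) (by simp)
  rw [hM]
  exact e21_mem_ElemNormal (mem_SLCong_two.1 (T * S⁻¹).2).2.2.1

theorem symb_congr_right (hφ : IsMennickeHom q φ) {a b b' : A} (h : IsRow q a b) (hb' : q ∣ b')
    (hd : a ∣ b' - b) : symb φ a b' = symb φ a b := by
  obtain ⟨T, ha, hb⟩ := h.exists_mem
  obtain ⟨k, hk⟩ := hd
  have hqk : k ∈ Ideal.span {q} := by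
    rw [Ideal.mem_span_singleton, show k = b' - b - (a - 1) * k by linear_combination -hk]
    exact dvd_sub (dvd_sub hb' h.dvd) (h.dvd_sub_one.mul_right k)
  have hmem := e12_mem_ElemNormal hqk
  set S : SLCong 2 (Ideal.span {q}) := T * ⟨e12 k, ElemNormal_le_SLCong _ _ hmem⟩ with hS
  rw [← hφ.eq_symb T ha hb, ← hφ.eq_symb S (a := a) (b := b')]
  · exact hφ.eq_mul (one_mem _) hmem (by rw [one_mul]; rfl)
  · simp [hS, sl2_mul_apply, ha]
  · simp only [hS, Subgroup.coe_mul, sl2_mul_apply, e12_01, e12_11, ha, hb]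
    linear_combination -hk

theorem symb_congr_left (hφ : IsMennickeHom q φ) {a a' b : A} (h : IsRow q a b)
    (hd : b ∣ a' - a) : symb φ a' b = symb φ a b := by
  obtain ⟨T, ha, hb⟩ := h.exists_mem
  obtain ⟨k, hk⟩ := hd
  set S : SLCong 2 (Ideal.span {q}) := ⟨(e21 k)⁻¹ * T.1 * ((e21 k)⁻¹)⁻¹,
    (SLCong_normal _ _).conj_mem _ T.2 _⟩ with hS
  rw [← hφ.eq_symb T ha hb, ← hφ.eq_symb S (a := a') (b := b)]
  · exact hφ.conj T S (e21 k) (e21_mem_Elem trivial) (by simp [hS])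
  · simp only [hS, inv_inv, sl2_mul_apply, sl2_inv_00, sl2_inv_01, e21_00, e21_01, e21_10, e21_11,
      ha, hb]
    linear_combination -hk
  · simp [hS, sl2_mul_apply, sl2_inv_00, sl2_inv_01, hb]

theorem symb_one (hφ : IsMennickeHom q φ) {b : A} (hb : q ∣ b) : symb φ 1 b = 1 := by
  rw [hφ.symb_congr_right (IsRow.one (dvd_zero q)) hb (one_dvd _)]
  exact (hφ.eq_symb 1 rfl rfl).symm.trans (map_one φ)

theorem symb_eq_one (hφ : IsMennickeHom q φ) {a b : A} (h : q ∣ b) (hd : b ∣ a - 1) :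
    symb φ a b = 1 := by
  rw [hφ.symb_congr_left (IsRow.one h) hd, hφ.symb_one h]

theorem symb_of_isUnit (hφ : IsMennickeHom q φ) {a b : A} (h : IsRow q a b) (ha : IsUnit a) :
    symb φ a b = 1 := by
  rw [hφ.symb_congr_right (b := 1 - a) ⟨h.dvd_sub_one, dvd_sub_comm.1 h.dvd_sub_one, 1, 1, by ring⟩
    h.dvd ha.dvd]
  exact hφ.symb_eq_one (dvd_sub_comm.1 h.dvd_sub_one) (dvd_sub_comm.1 dvd_rfl)

/-- The transpose is conjugate to the inverse by the Weyl element. -/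
theorem symb_transpose (hφ : IsMennickeHom q φ) (T : SLCong 2 (Ideal.span {q})) :
    symb φ (T.1 0 0) (T.1 1 0) = (φ T)⁻¹ := by
  set S : SLCong 2 (Ideal.span {q}) := ⟨weyl⁻¹ * T⁻¹.1 * (weyl⁻¹)⁻¹,
    (SLCong_normal _ _).conj_mem _ T⁻¹.2 _⟩ with hS
  rw [← map_inv, ← hφ.conj T⁻¹ S weyl weyl_mem_Elem (by simp [hS])]
  refine (hφ.eq_symb S ?_ ?_).symm <;>
    simp [hS, sl2_mul_apply, sl2_inv_00, sl2_inv_01, sl2_inv_10, sl2_inv_11, weyl]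

/-- Replacing `b` by `u² b` changes the symbol by a factor that does not depend on `b`. Indeed, the
quotient of two matrices with the same entry `h` and with lower left entries in `u²qA` is, up to
`E₁₂(τ)`, in `SL(2, A; u²qA)`. -/
theorem symb_sq_mul (hφ : IsMennickeHom q φ) {h u b₁ b₂ : A} (hu : u ≠ 0) (hhu : IsCoprime h u)
    (h₁ : IsRow q h b₁) (h₂ : IsRow q h b₂) :
    symb φ h (u ^ 2 * b₁) * symb φ h b₂ = symb φ h (u ^ 2 * b₂) * symb φ h b₁ := by
  have key : ∀ b, IsRow q h b → ∃ T T' : SLCong 2 (Ideal.span {q}), T.1 0 0 = h ∧ T.1 0 1 = b ∧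
      T'.1 0 0 = h ∧ T'.1 0 1 = u ^ 2 * b ∧ u ^ 2 * T'.1 1 0 = T.1 1 0 ∧ T'.1 1 1 = T.1 1 1 ∧
      q ∣ T'.1 1 0 := by
    intro b hb
    obtain ⟨T, hTa, hTb⟩ := hb.exists_mem
    obtain ⟨x, y, hxy⟩ : IsCoprime h (u ^ 2) := hhu.pow_right
    obtain ⟨c, hc⟩ := (mem_SLCong_span.1 T.2).2.2.1
    have d := sl2_det T.1
    rw [hTa, hTb] at d
    have hd : h * (T.1 1 1 - q * c * x * b) - b * (u ^ 2 * (q * (c * y))) = 1 := by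
      linear_combination d + b * hc - b * q * c * hxy
    refine ⟨⟨sl2 h b (u ^ 2 * (q * (c * y))) (T.1 1 1 - q * c * x * b) hd,
      mem_SLCong_two_of ?_ ?_ ?_⟩,
      ⟨sl2 h (u ^ 2 * b) (q * (c * y)) (T.1 1 1 - q * c * x * b) (by linear_combination hd),
        mem_SLCong_two_of ?_ ?_ ?_⟩, rfl, rfl, rfl, rfl, rfl, rfl, ⟨c * y, rfl⟩⟩ <;>
      simp only [sl2_00, sl2_01, sl2_10, Ideal.mem_span_singleton]
    · exact hb.dvd_sub_one
    · exact hb.dvd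
    · exact (dvd_mul_right _ _).mul_left _
    · exact hb.dvd_sub_one
    · exact hb.dvd.mul_left _
    · exact dvd_mul_right _ _
  obtain ⟨T₁, T₁', a1, a2, a3, a4, a5, a6, c₁, a7⟩ := key b₁ h₁
  obtain ⟨T₂, T₂', g1, g2, g3, g4, g5, g6, c₂, g7⟩ := key b₂ h₂
  have d₁ := sl2_det T₁.1
  have d₂ := sl2_det T₂.1
  have hτ : h * (b₁ - b₂) ∈ Ideal.span {q} :=
    Ideal.mem_span_singleton.2 ((dvd_sub h₁.dvd h₂.dvd).mul_left h)
  set τ := h * (b₁ - b₂) with hτd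
  have m₁ := e12_mem_ElemNormal (Ideal.neg_mem_iff _ |>.2 hτ)
  have m₂ := e12_mem_ElemNormal (Ideal.neg_mem_iff _ |>.2 (Ideal.mul_mem_left _ (u ^ 2) hτ))
  set Q : SLCong 2 (Ideal.span {q}) :=
    ⟨e12 (-τ), ElemNormal_le_SLCong _ _ m₁⟩ * (T₁ * T₂⁻¹) with hQ
  set Q' : SLCong 2 (Ideal.span {q}) :=
    ⟨e12 (-(u ^ 2 * τ)), ElemNormal_le_SLCong _ _ m₂⟩ * (T₁' * T₂'⁻¹) with hQ'
  have E : φ Q' = φ Q := by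
    rw [a7] at a5
    rw [g7] at g5
    refine hφ.diag u hu Q Q' (mem_SLCong_two_of ?_ ?_ ?_) ?_ ?_ ?_ ?_ <;>
      simp only [hQ, hQ', Subgroup.coe_mul, Subgroup.coe_inv, sl2_mul_apply, sl2_inv_00, sl2_inv_01,
        sl2_inv_10, sl2_inv_11, e12_00, e12_01, e12_10, e12_11, Ideal.mem_span_singleton,
        a1, a2, a3, a4, a6, a7, g1, g2, g3, g4, g6, g7, ← a5, ← g5] at d₁ d₂ ⊢
    · exact ⟨c₂ * (b₂ - b₁) - τ * (c₁ * T₂.1 1 1 - T₁.1 1 1 * c₂), by linear_combination d₂⟩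
    · exact ⟨-τ * (c₁ * (b₁ - b₂)), by rw [hτd]; linear_combination -h * (b₁ - b₂) * d₁⟩
    · exact ⟨c₁ * T₂.1 1 1 - T₁.1 1 1 * c₂, by ring⟩
    · ring
    · ring
    · ring
    · ring
  have E₁ : φ Q = φ T₁ * (φ T₂)⁻¹ := by
    rw [hQ, map_mul, hφ.ker ⟨e12 (-τ), _⟩ m₁, one_mul, map_mul, map_inv]
  have E₂ : φ Q' = φ T₁' * (φ T₂')⁻¹ := by
    rw [hQ', map_mul, hφ.ker ⟨e12 (-(u ^ 2 * τ)), _⟩ m₂, one_mul, map_mul, map_inv]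
  rw [← hφ.eq_symb T₁ a1 a2, ← hφ.eq_symb T₁' a3 a4, ← hφ.eq_symb T₂ g1 g2,
    ← hφ.eq_symb T₂' g3 g4]
  rw [E₁, E₂, ← div_eq_mul_inv, ← div_eq_mul_inv, div_eq_div_iff_mul_eq_mul] at E
  rw [E, mul_comm]

end IsMennickeHom

/-- For `h` congruent to `1` modulo `q`, the symbol `[b; h]` as a function of the residue class of
`b` modulo `h`: a class is represented by a multiple of `q`. -/
noncomputable def residueSymb (φ : SLCong 2 (Ideal.span {q}) →* C) (h β : A) : C :=
  symb φ h (β * (1 - h))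

namespace IsMennickeHom

theorem residueSymb_congr (hφ : IsMennickeHom q φ) {h β β' : A} (hh : q ∣ h - 1)
    (hβ : IsCoprime h β) (hd : h ∣ β' - β) : residueSymb φ h β' = residueSymb φ h β := by
  refine hφ.symb_congr_right (isRow_mul_one_sub hh hβ) ((dvd_sub_comm.1 hh).mul_left _) ?_
  rw [← sub_mul]
  exact hd.mul_right _

theorem residueSymb_of_isRow (hφ : IsMennickeHom q φ) {h b : A} (hb : IsRow q h b) :
    residueSymb φ h b = symb φ h b :=
  hφ.symb_congr_right hb (hb.dvd.mul_right _) ⟨-b, by ring⟩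

theorem residueSymb_one (hφ : IsMennickeHom q φ) {h : A} (hh : q ∣ h - 1) :
    residueSymb φ h 1 = 1 := by
  rw [residueSymb, one_mul]
  exact hφ.symb_eq_one (dvd_sub_comm.1 hh) (dvd_sub_comm.1 dvd_rfl)

/-- Transposing a matrix with upper left entry `h` replaces `β` by a class `γ` with `β γ ≡ -1` and
inverts the symbol. -/
theorem residueSymb_mul_eq_one (hφ : IsMennickeHom q φ) {h β γ : A} (hh : q ∣ h - 1)
    (hd : h ∣ β * γ + 1) : residueSymb φ h β * residueSymb φ h γ = 1 := by
  obtain ⟨e, he⟩ := hd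
  have hβ : IsCoprime h β := ⟨e, -γ, by linear_combination -he⟩
  have hγ : IsCoprime h γ := ⟨e, -β, by linear_combination -he⟩
  obtain ⟨T, ha, hb⟩ := (isRow_mul_one_sub hh hβ).exists_mem
  have d := sl2_det T.1
  have hc := (mem_SLCong_span.1 T.2).2.2.1
  have hT := hφ.symb_transpose T
  rw [ha, hb] at d
  rw [hφ.eq_symb T ha hb, ha] at hT
  have h2 : residueSymb φ h γ = symb φ h (T.1 1 0) := by
    refine (hφ.symb_congr_right (isRow_mul_one_sub hh hγ) hc
      ⟨-(γ * T.1 1 1) + e * (1 - h) * T.1 1 0 + T.1 1 0 + γ, ?_⟩).symm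
    linear_combination γ * d + (1 - h) * T.1 1 0 * he
  rw [h2, hT]
  exact mul_inv_cancel _

theorem residueSymb_neg_one (hφ : IsMennickeHom q φ) {h : A} (hh : q ∣ h - 1) :
    residueSymb φ h (-1) = 1 := by
  have := hφ.residueSymb_mul_eq_one (β := -1) (γ := 1) hh (by simp)
  rwa [hφ.residueSymb_one hh, mul_one] at this

theorem residueSymb_sq_mul (hφ : IsMennickeHom q φ) {h u β : A} (hh : q ∣ h - 1)
    (hu : IsCoprime h u) (hβ : IsCoprime h β) :
    residueSymb φ h (u ^ 2 * β) = residueSymb φ h (u ^ 2) * residueSymb φ h β := by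
  by_cases hu0 : u = 0
  · have hunit : IsUnit h := by rwa [hu0, isCoprime_zero_right] at hu
    rw [residueSymb, residueSymb, residueSymb,
      hφ.symb_of_isUnit (isRow_mul_one_sub hh (hu.pow_right.mul_right hβ)) hunit,
      hφ.symb_of_isUnit (isRow_mul_one_sub hh hu.pow_right) hunit,
      hφ.symb_of_isUnit (isRow_mul_one_sub hh hβ) hunit, one_mul]
  · have h1 := hφ.symb_sq_mul hu0 hu (isRow_mul_one_sub hh hβ)
      (isRow_mul_one_sub hh (isCoprime_one_right (x := h)))
    have h2 := hφ.residueSymb_one hh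
    rw [residueSymb] at h2
    rw [h2, mul_one, one_mul, ← mul_assoc] at h1
    exact h1

/-- If the group of units modulo `h` is cyclic modulo squares, then the symbol is multiplicative:
of two classes and their product, one is a square, and `-1` is either a square or has a
square as its product with any nonsquare. -/
theorem residueSymb_mul_of_sq (hφ : IsMennickeHom q φ) {h β γ : A} (hh : q ∣ h - 1)
    (hβ : IsCoprime h β) (hγ : IsCoprime h γ)
    (hsq : ∀ x y : A, IsCoprime h x → IsCoprime h y →
      (∃ z, h ∣ x - z ^ 2) ∨ (∃ z, h ∣ y - z ^ 2) ∨ ∃ z, h ∣ x * y - z ^ 2) :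
    residueSymb φ h (β * γ) = residueSymb φ h β * residueSymb φ h γ := by
  have cop : ∀ {x z : A}, IsCoprime h x → h ∣ x - z ^ 2 → IsCoprime h z := by
    rintro x z hx ⟨k, hk⟩
    rw [show x = z ^ 2 + h * k by linear_combination hk] at hx
    have := hx.add_mul_left_right (-k)
    rw [show z ^ 2 + h * k + h * -k = z ^ 2 by ring] at this
    exact (IsCoprime.pow_right_iff (by norm_num)).1 this
  have sq : ∀ {x y z : A}, IsCoprime h x → IsCoprime h y → h ∣ x - z ^ 2 →
      residueSymb φ h (x * y) = residueSymb φ h x * residueSymb φ h y := by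
    intro x y z hx hy hz
    have hcz := cop hx hz
    rw [hφ.residueSymb_congr hh hcz.pow_right hz,
      hφ.residueSymb_congr hh (hcz.pow_right.mul_right hy) (β' := x * y)
        (by rw [← sub_mul]; exact hz.mul_right y),
      hφ.residueSymb_sq_mul hh hcz hy]
  have hneg : IsCoprime h (-1) := isCoprime_one_right.neg_right
  by_cases h1 : ∃ z, h ∣ β - z ^ 2
  · obtain ⟨z, hz⟩ := h1
    exact sq hβ hγ hz
  by_cases h2 : ∃ z, h ∣ γ - z ^ 2
  · obtain ⟨z, hz⟩ := h2
    rw [mul_comm, sq hγ hβ hz, mul_comm]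
  by_cases h3 : ∃ z, h ∣ -1 - z ^ 2
  · obtain ⟨w, hw⟩ := h3
    obtain ⟨z, hz⟩ := ((hsq β γ hβ hγ).resolve_left h1).resolve_left h2
    have hcw := cop hneg hw
    have hcz := cop (hβ.mul_right hγ) hz
    -- `γ'` is an inverse of `-γ` modulo `h`, and `β` is the square `(z w)²` times `γ'`
    obtain ⟨e, γ', hγ'⟩ := hγ
    have hcγ' : IsCoprime h γ' := ⟨e, γ, by linear_combination hγ'⟩
    have i1 : residueSymb φ h (-γ') * residueSymb φ h γ = 1 :=
      hφ.residueSymb_mul_eq_one hh ⟨e, by linear_combination -hγ'⟩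
    have i2 : residueSymb φ h β = residueSymb φ h ((z * w) ^ 2 * -γ') := by
      refine hφ.residueSymb_congr hh ((hcz.mul_right hcw).pow_right.mul_right hcγ'.neg_right) ?_
      obtain ⟨k, hk⟩ := hw
      obtain ⟨l, hl⟩ := hz
      refine ⟨β * e + γ' * l + -γ' * z ^ 2 * k, ?_⟩
      linear_combination -β * hγ' + γ' * hl - γ' * z ^ 2 * hk
    have i3 : residueSymb φ h ((z * w) ^ 2) = residueSymb φ h (β * γ) := by
      have : residueSymb φ h ((z * w) ^ 2) = residueSymb φ h (z ^ 2 * (-1)) := by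
        refine hφ.residueSymb_congr hh (hcz.pow_right.mul_right hneg) ?_
        obtain ⟨k, hk⟩ := hw
        exact ⟨-z ^ 2 * k, by linear_combination -z ^ 2 * hk⟩
      rw [this, hφ.residueSymb_sq_mul hh hcz hneg, hφ.residueSymb_neg_one hh, mul_one]
      exact (hφ.residueSymb_congr hh hcz.pow_right hz).symm
    rw [i2, hφ.residueSymb_sq_mul hh (hcz.mul_right hcw) hcγ'.neg_right, i3, mul_assoc, i1, mul_one]
  · obtain ⟨z, hz⟩ := ((hsq (-1) β hneg hβ).resolve_left h3).resolve_left h1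
    obtain ⟨w, hw⟩ := ((hsq (-1) γ hneg hγ).resolve_left h3).resolve_left h2
    have hcz := cop (hneg.mul_right hβ) hz
    have hcw := cop (hneg.mul_right hγ) hw
    have drop : ∀ {x y : A}, IsCoprime h y → h ∣ -1 * x - y ^ 2 →
        residueSymb φ h x = residueSymb φ h (y ^ 2) := by
      rintro x y hy ⟨k, hk⟩
      rw [hφ.residueSymb_congr hh (hy.pow_right.mul_right hneg) (β := y ^ 2 * -1) (β' := x)
        ⟨-k, by linear_combination -hk⟩,
        hφ.residueSymb_sq_mul hh hy hneg, hφ.residueSymb_neg_one hh, mul_one]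
    rw [drop hcz hz, drop hcw hw, ← hφ.residueSymb_sq_mul hh hcz hcw.pow_right]
    refine hφ.residueSymb_congr hh (hcz.pow_right.mul_right hcw.pow_right) ?_
    obtain ⟨k, hk⟩ := hz
    obtain ⟨l, hl⟩ := hw
    exact ⟨-k * γ + z ^ 2 * l, by linear_combination -γ * hk + z ^ 2 * hl⟩

end IsMennickeHom

end Mennicke

/-! ### Cyclic groups of units modulo squares -/

section Units

variable {A : Type*} [CommRing A]

theorem isUnit_mk_of_isCoprime {h x : A} (hx : IsCoprime h x) :
    IsUnit (Ideal.Quotient.mk (Ideal.span {h}) x) := by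
  obtain ⟨a, b, hab⟩ := hx
  refine IsUnit.of_mul_eq_one (Ideal.Quotient.mk _ b) ?_
  rw [← map_mul, ← map_one (Ideal.Quotient.mk (Ideal.span {h})), Ideal.Quotient.eq,
    Ideal.mem_span_singleton]
  exact ⟨-a, by linear_combination hab⟩

theorem mk_eq_mk_iff_dvd {h x y : A} :
    Ideal.Quotient.mk (Ideal.span {h}) x = Ideal.Quotient.mk (Ideal.span {h}) y ↔ h ∣ x - y := by
  rw [Ideal.Quotient.eq, Ideal.mem_span_singleton]

theorem isCoprime_of_isUnit_mk {h x : A} (hx : IsUnit (Ideal.Quotient.mk (Ideal.span {h}) x)) :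
    IsCoprime h x := by
  obtain ⟨b, hb⟩ := hx.exists_left_inv
  obtain ⟨b, rfl⟩ := Ideal.Quotient.mk_surjective b
  rw [← map_mul, ← map_one (Ideal.Quotient.mk (Ideal.span {h})), mk_eq_mk_iff_dvd] at hb
  obtain ⟨k, hk⟩ := hb
  exact ⟨-k, b, by linear_combination hk⟩

/-- In a group of exponent `2` with at most one generator, one of two elements and their product is
trivial. -/
theorem GeneratedByAtMost.eq_one_or {G : Type*} [Group G] (hG : GeneratedByAtMost G 1)
    (h2 : ∀ g : G, g ^ 2 = 1) (x y : G) : x = 1 ∨ y = 1 ∨ x * y = 1 := by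
  obtain ⟨S, hS, htop⟩ := hG
  obtain ⟨s, hs⟩ : ∃ s : G, S ⊆ {s} := Finset.card_le_one_iff_subset_singleton.1 hS
  have hx : ∀ x : G, x = 1 ∨ x = s := by
    intro x
    have hx : x ∈ Subgroup.zpowers s := by
      rw [Subgroup.zpowers_eq_closure]
      refine Subgroup.closure_mono (h := (S : Set G)) (k := {s}) (by exact_mod_cast hs) ?_
      rw [htop]; trivial
    obtain ⟨n, rfl⟩ := Subgroup.mem_zpowers_iff.1 hx
    rcases Int.even_or_odd' n with ⟨m, rfl | rfl⟩
    · left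
      rw [zpow_mul]
      norm_cast
      rw [h2, one_zpow]
    · right
      rw [zpow_add, zpow_mul]
      norm_cast
      rw [h2, one_zpow, one_mul, pow_one]
  rcases hx x with rfl | rfl
  · exact Or.inl rfl
  rcases hx y with rfl | rfl
  · exact Or.inr (Or.inl rfl)
  · exact Or.inr (Or.inr (by rw [← sq, h2]))

theorem GeneratedByAtMost.exists_sq {h : A}
    (hh : GeneratedByAtMost ((A ⧸ Ideal.span {h})ˣ ⧸
      (powMonoidHom 2 : (A ⧸ Ideal.span {h})ˣ →* (A ⧸ Ideal.span {h})ˣ).range) 1) {x y : A}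
    (hx : IsCoprime h x) (hy : IsCoprime h y) :
    (∃ z, h ∣ x - z ^ 2) ∨ (∃ z, h ∣ y - z ^ 2) ∨ ∃ z, h ∣ x * y - z ^ 2 := by
  have lift : ∀ {x : A} (u : (A ⧸ Ideal.span {h})ˣ), (u : A ⧸ Ideal.span {h}) =
      Ideal.Quotient.mk _ x → (u : (A ⧸ Ideal.span {h})ˣ ⧸
      (powMonoidHom 2 : (A ⧸ Ideal.span {h})ˣ →* (A ⧸ Ideal.span {h})ˣ).range) = 1 →
      ∃ z, h ∣ x - z ^ 2 := by
    intro x u hu h1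
    rw [QuotientGroup.eq_one_iff] at h1
    obtain ⟨v, hv⟩ := h1
    obtain ⟨z, hz⟩ := Ideal.Quotient.mk_surjective (v : A ⧸ Ideal.span {h})
    refine ⟨z, mk_eq_mk_iff_dvd.1 ?_⟩
    rw [← hu, ← hv, map_pow, hz]
    simp
  obtain ⟨u, hu⟩ := isUnit_mk_of_isCoprime hx
  obtain ⟨v, hv⟩ := isUnit_mk_of_isCoprime hy
  have h2 : ∀ g : (A ⧸ Ideal.span {h})ˣ ⧸
      (powMonoidHom 2 : (A ⧸ Ideal.span {h})ˣ →* (A ⧸ Ideal.span {h})ˣ).range, g ^ 2 = 1 := by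
    intro g
    obtain ⟨g, rfl⟩ := QuotientGroup.mk_surjective g
    rw [← QuotientGroup.mk_pow, QuotientGroup.eq_one_iff]
    exact ⟨g, rfl⟩
  rcases hh.eq_one_or h2 u v with h | h | h
  · exact Or.inl (lift u hu h)
  · exact Or.inr (Or.inl (lift v hv h))
  · exact Or.inr (Or.inr (lift (u * v) (by rw [Units.val_mul, hu, hv, map_mul]) h))

end Units

/-! ### Multiplicativity and exponent of Mennicke symbols -/

section Mennicke

variable {A : Type*} [CommRing A] {q : A} {C : Type*} [CommGroup C]
  {φ : SLCong 2 (Ideal.span {q}) →* C}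

namespace IsMennickeHom

theorem symb_mul_right (hφ : IsMennickeHom q φ) (hGEN : GEN A 2 1) {a b b' : A}
    (h : IsRow q a b) (h' : IsRow q a b') :
    symb φ a (b * b') = symb φ a b * symb φ a b' := by
  have hm := h.mul_right h'
  -- move `a` modulo `b b'` to make the units modulo `a` cyclic modulo squares
  obtain ⟨k, hk, hgen⟩ := hGEN a (b * b') hm.coprime
  rw [Ideal.mem_span_singleton] at hk
  have d : b ∣ k - a := (dvd_mul_right b b').trans hk
  have d' : b' ∣ k - a := (dvd_mul_left b' b).trans hk
  have r := h.congr_left d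
  have r' := h'.congr_left d'
  rw [← hφ.symb_congr_left hm hk, ← hφ.symb_congr_left h d, ← hφ.symb_congr_left h' d',
    ← hφ.residueSymb_of_isRow (hm.congr_left hk), ← hφ.residueSymb_of_isRow r,
    ← hφ.residueSymb_of_isRow r']
  exact hφ.residueSymb_mul_of_sq r.dvd_sub_one r.coprime r'.coprime
    fun x y hx hy => hgen.exists_sq hx hy

theorem residueSymb_mul (hφ : IsMennickeHom q φ) (hGEN : GEN A 2 1) {h β γ : A} (hh : q ∣ h - 1)
    (hβ : IsCoprime h β) (hγ : IsCoprime h γ) :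
    residueSymb φ h (β * γ) = residueSymb φ h β * residueSymb φ h γ := by
  have r := isRow_mul_one_sub hh hβ
  have r' := isRow_mul_one_sub hh hγ
  rw [residueSymb, residueSymb, residueSymb, ← hφ.symb_mul_right hGEN r r']
  exact (hφ.symb_congr_right (isRow_mul_one_sub hh (hβ.mul_right hγ)) (r.mul_right r').dvd
    ⟨-(β * γ * (1 - h)), by ring⟩).symm

/-- Multiplicativity in the first entry follows from multiplicativity in the second one: the product
of a matrix with first row `(a a', b)` and the inverse of one with first row `(a', b)` has first
row `(1 - m d', m b)`, where `m = a' - a a'`. -/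
theorem symb_mul_left (hφ : IsMennickeHom q φ) (hGEN : GEN A 2 1) {a a' b : A}
    (h : IsRow q a b) (h' : IsRow q a' b) :
    symb φ (a * a') b = symb φ a b * symb φ a' b := by
  obtain ⟨T, hT0, hT1⟩ := (h.mul_left h').exists_mem
  obtain ⟨S, hS0, hS1⟩ := h'.exists_mem
  have d := sl2_det S.1
  rw [hS0, hS1] at d
  set m := a' - a * a' with hm
  set X := 1 - m * S.1 1 1 with hX
  have e0 : (T * S⁻¹).1 0 0 = X := by
    simp only [Subgroup.coe_mul, Subgroup.coe_inv, sl2_mul_apply, sl2_inv_00, sl2_inv_10, hT0, hT1,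
      hX, hm]
    linear_combination d
  have e1 : (T * S⁻¹).1 0 1 = b * m := by
    simp only [Subgroup.coe_mul, Subgroup.coe_inv, sl2_mul_apply, sl2_inv_01, sl2_inv_11, hT0, hT1,
      hS0, hS1, hm]
    ring
  have hrow := isRow_of_mem (T * S⁻¹)
  rw [e0, e1] at hrow
  have hqm : q ∣ m := by
    rw [hm, show a' - a * a' = -(a' * (a - 1)) by ring]
    exact (h.dvd_sub_one.mul_left a').neg_right
  have hb : b ∣ X - a := ⟨a * S.1 1 0 - S.1 1 0, by rw [hX, hm]; linear_combination (a - 1) * d⟩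
  have key : φ T * (φ S)⁻¹ = symb φ a b := by
    rw [← map_inv, ← map_mul, hφ.eq_symb (T * S⁻¹) e0 e1,
      hφ.symb_mul_right hGEN ⟨hrow.dvd_sub_one, h.dvd, hrow.coprime.of_mul_right_left⟩
        ⟨hrow.dvd_sub_one, hqm, hrow.coprime.of_mul_right_right⟩,
      hφ.symb_eq_one hqm ⟨-S.1 1 1, by rw [hX]; ring⟩, mul_one, hφ.symb_congr_left h hb]
  rw [← key, hφ.eq_symb T hT0 hT1, hφ.eq_symb S hS0 hS1, inv_mul_cancel_right]

theorem symb_prod_left (hφ : IsMennickeHom q φ) (hGEN : GEN A 2 1) {b : A} (hb : q ∣ b)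
    {ι : Type*} (s : Finset ι) (f : ι → A) (hf : ∀ i ∈ s, IsRow q (f i) b) :
    IsRow q (∏ i ∈ s, f i) b ∧ symb φ (∏ i ∈ s, f i) b = ∏ i ∈ s, symb φ (f i) b := by
  classical
  induction s using Finset.induction_on with
  | empty => simpa using ⟨IsRow.one hb, hφ.symb_one hb⟩
  | insert i s hi ih =>
    obtain ⟨h₁, h₂⟩ := ih fun j hj => hf j (Finset.mem_insert_of_mem hj)
    have h₃ := hf i (Finset.mem_insert_self i s)
    rw [Finset.prod_insert hi, Finset.prod_insert hi, hφ.symb_mul_left hGEN h₃ h₁, h₂]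
    exact ⟨h₃.mul_left h₁, rfl⟩

theorem symb_pow_left (hφ : IsMennickeHom q φ) (hGEN : GEN A 2 1) {a b : A} (h : IsRow q a b)
    (n : ℕ) : symb φ (a ^ n) b = symb φ a b ^ n := by
  have := (hφ.symb_prod_left hGEN h.dvd (Finset.range n) (fun _ => a) fun _ _ => h).2
  simpa using this

/-- If `f + g T` lies in `SL(2, A; qA)` and its upper left entry `x` is congruent to a unit modulo
`b`, then `[c; x] = 1`. The rows and columns of `f + g T` give `[g b; x] [g c; x] = 1`, where
`[b; x] = 1`. Moreover `x² = 1 + g λ` for an element `λ` of `qA`, whence `g` has trivial symbol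
modulo `x²`. -/
theorem symb_eq_one_of_linear (hφ : IsMennickeHom q φ) (hGEN : GEN A 2 1)
    (T M : SLCong 2 (Ideal.span {q})) {f g u : A}
    (h00 : M.1 0 0 = f + g * T.1 0 0) (h01 : M.1 0 1 = g * T.1 0 1)
    (h10 : M.1 1 0 = g * T.1 1 0) (h11 : M.1 1 1 = f + g * T.1 1 1)
    (hu : IsUnit u) (hxu : T.1 0 1 ∣ f + g * T.1 0 0 - u) :
    symb φ (M.1 0 0) (T.1 1 0) = 1 := by
  obtain ⟨t0, t1, t2, t3⟩ := mem_SLCong_span.1 T.2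
  have dT := sl2_det T.1
  have dM := sl2_det M.1
  rw [h01, h10] at dM
  have hrow := isRow_of_mem M
  rw [← h00] at hxu
  set x := M.1 0 0 with hx
  have hx1 : q ∣ x - 1 := hrow.dvd_sub_one
  have hxg : IsCoprime x g :=
    ⟨M.1 1 1, -(T.1 0 1 * (g * T.1 1 0)), by linear_combination dM⟩
  have hxb : IsRow q x (T.1 0 1) :=
    ⟨hx1, t1, M.1 1 1, -(g * (g * T.1 1 0)), by linear_combination dM⟩
  have hxc : IsRow q x (T.1 1 0) :=
    ⟨hx1, t2, M.1 1 1, -(g * T.1 0 1 * g), by linear_combination dM⟩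
  have r1 : φ M = residueSymb φ x g := by
    rw [hφ.eq_symb M rfl h01, ← hφ.residueSymb_of_isRow (h01 ▸ hrow),
      hφ.residueSymb_mul hGEN hx1 hxg hxb.coprime, hφ.residueSymb_of_isRow hxb,
      ← hφ.symb_congr_left hxb (dvd_sub_comm.1 hxu),
      hφ.symb_of_isUnit (hxb.congr_left (dvd_sub_comm.1 hxu)) hu, mul_one]
  have r2 : (φ M)⁻¹ = residueSymb φ x g * symb φ x (T.1 1 0) := by
    rw [← hφ.symb_transpose M, h10, ← hφ.residueSymb_of_isRow hxc,
      ← hφ.residueSymb_mul hGEN hx1 hxg hxc.coprime, hφ.residueSymb_of_isRow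
        ⟨hx1, t2.mul_left g, hxg.mul_right hxc.coprime⟩]
  have r3 : residueSymb φ x g ^ 2 = 1 := by
    have hx2 : q ∣ x ^ 2 - 1 := by
      rw [show x ^ 2 - 1 = (x - 1) * (x + 1) by ring]
      exact hx1.mul_right _
    have hrx := isRow_mul_one_sub hx1 hxg
    have h1x := isRow_mul_one_sub hx1 (isCoprime_one_right (x := x))
    rw [one_mul] at h1x
    have hrx2 : IsRow q (x ^ 2) (1 - x) := by rw [sq]; exact h1x.mul_left h1x
    have hrx2' : IsRow q (x ^ 2) (g * (1 - x)) := by rw [sq]; exact hrx.mul_left hrx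
    set lam := f * (T.1 0 0 - T.1 1 1) + g * (T.1 0 0 ^ 2 - 1) with hlam
    have hgl : g * lam = x ^ 2 - 1 := by
      rw [h11] at dM
      rw [hlam, h00]
      rw [h00] at dM
      linear_combination -dM + g ^ 2 * dT
    have hql : q ∣ lam := by
      rw [hlam, show f * (T.1 0 0 - T.1 1 1) + g * (T.1 0 0 ^ 2 - 1) =
        f * (T.1 0 0 - 1) - f * (T.1 1 1 - 1) + g * (T.1 0 0 + 1) * (T.1 0 0 - 1) by ring]
      exact dvd_add (dvd_sub (t0.mul_left f) (t3.mul_left f)) (t0.mul_left _)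
    have hxl : IsRow q (x ^ 2) lam := ⟨hx2, hql, 1, -g, by linear_combination -hgl⟩
    have s1 : residueSymb φ (x ^ 2) g = 1 := by
      have s2 := hφ.residueSymb_mul hGEN hx2 (hxg.pow_left (m := 2)) hxl.coprime
      rw [hφ.residueSymb_of_isRow hxl, hφ.symb_eq_one hql ⟨g, by linear_combination -hgl⟩, mul_one,
        hφ.residueSymb_congr hx2 (β := -1) isCoprime_one_right.neg_right
          ⟨1, by linear_combination hgl⟩, hφ.residueSymb_neg_one hx2] at s2
      exact s2.symm
    rw [residueSymb, ← hφ.symb_pow_left hGEN hrx, ← hφ.residueSymb_of_isRow hrx2',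
      hφ.residueSymb_mul hGEN hx2 (hxg.pow_left) hrx2.coprime, s1, one_mul,
      hφ.residueSymb_of_isRow hrx2, hφ.symb_pow_left hGEN h1x,
      hφ.symb_eq_one h1x.dvd (dvd_sub_comm.1 dvd_rfl), one_pow]
  rw [r1] at r2
  calc symb φ x (T.1 1 0)
      = (residueSymb φ x g)⁻¹ * (residueSymb φ x g * symb φ x (T.1 1 0)) := by group
    _ = (residueSymb φ x g ^ 2)⁻¹ := by rw [← r2, sq, mul_inv]
    _ = 1 := by rw [r3, inv_one]

/-- The exponent property writes the `t`-th power of a first entry as a product of squares of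
elements with trivial symbol. -/
theorem pow_eq_one (hφ : IsMennickeHom q φ) (hq : q ≠ 0) (hGEN : GEN A 2 1) {t l : ℕ}
    (hEXP : EXP A t l) (T : SLCong 2 (Ideal.span {q})) : φ T ^ t = 1 := by
  have hT := isRow_of_mem T
  obtain ⟨a', c, d, u, f, g, b', d', ha', ⟨S, hS, eS⟩, hSi, hMi, hprod, hu⟩ :=
    hEXP q hq (T.1 0 0) (T.1 0 1) ⟨Ideal.mem_span_singleton.2 hT.dvd_sub_one,
      Ideal.mem_span_singleton.2 hT.dvd, hT.coprime⟩
  rw [Ideal.mem_span_singleton] at ha' hprod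
  have S00 : S 0 0 = a' := by rw [eS]; rfl
  have S01 : S 0 1 = T.1 0 1 := by rw [eS]; rfl
  have S10 : S 1 0 = c := by rw [eS]; rfl
  have hTS : φ T = φ ⟨S, hS⟩ := by
    rw [hφ.eq_symb T rfl rfl, hφ.eq_symb ⟨S, hS⟩ S00 S01, hφ.symb_congr_left hT ha']
  have hqc : q ∣ c := S10 ▸ (mem_SLCong_span.1 hS).2.2.1
  have hac : IsRow q a' c := by
    refine ⟨S00 ▸ (mem_SLCong_span.1 hS).1, hqc, S 1 1, -S 0 1, ?_⟩
    have := sl2_det S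
    rw [S00, S10] at this
    linear_combination this
  have hSc : symb φ a' c = (φ T)⁻¹ := by
    rw [hTS, ← hφ.symb_transpose]
    simp only [S00, S10]
  have hrow : IsRow q (∏ i, (f i + g i * a') ^ 2) c := by
    refine IsRow.congr_left (a := a' ^ t) ⟨?_, hqc, hac.coprime.pow_left⟩ hprod
    exact hac.dvd_sub_one.trans (sub_one_dvd_pow_sub_one a' t)
  have hxi : ∀ i, IsRow q (f i + g i * a') c ∧ symb φ (f i + g i * a') c = 1 := by
    intro i
    obtain ⟨Si, hSi, eSi⟩ := hSi i
    obtain ⟨Mi, hMi, eMi⟩ := hMi i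
    obtain ⟨hui, hxu⟩ := hu i
    rw [Ideal.mem_span_singleton] at hxu
    have i00 : Si 0 0 = a' := by rw [eSi]; rfl
    have i01 : Si 0 1 = b' i := by rw [eSi]; rfl
    have i10 : Si 1 0 = c := by rw [eSi]; rfl
    have i11 : Si 1 1 = d' i := by rw [eSi]; rfl
    have j00 : Mi 0 0 = f i + g i * a' := by rw [eMi]; simp
    have j01 : Mi 0 1 = g i * b' i := by rw [eMi]; simp
    have j10 : Mi 1 0 = g i * c := by rw [eMi]; simp
    have j11 : Mi 1 1 = f i + g i * d' i := by rw [eMi]; simp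
    have key := hφ.symb_eq_one_of_linear hGEN ⟨Si, hSi⟩ ⟨Mi, hMi⟩ (f := f i) (g := g i) (u := u i)
      (by simp only [i00, j00]) (by simp only [i01, j01]) (by simp only [i10, j10])
      (by simp only [i11, j11]) hui (by simpa only [i01, i00] using hxu)
    simp only [j00, i10] at key
    refine ⟨⟨j00 ▸ (mem_SLCong_span.1 hMi).1, hqc, ?_⟩, key⟩
    have := IsCoprime.of_prod_left hrow.coprime i (Finset.mem_univ i)
    exact (IsCoprime.pow_left_iff (by norm_num)).1 this
  have h2 : ∀ i, IsRow q ((f i + g i * a') ^ 2) c := fun i => by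
    rw [sq]; exact (hxi i).1.mul_left (hxi i).1
  have h1 : symb φ (a' ^ t) c = 1 := by
    rw [hφ.symb_congr_left (a' := a' ^ t) hrow (dvd_sub_comm.1 hprod),
      (hφ.symb_prod_left hGEN hqc Finset.univ _ fun i _ => h2 i).2]
    refine Finset.prod_eq_one fun i _ => ?_
    rw [hφ.symb_pow_left hGEN (hxi i).1, (hxi i).2, one_pow]
  rw [hφ.symb_pow_left hGEN hac, hSc, inv_pow, inv_eq_one] at h1
  exact h1

end IsMennickeHom

end Mennicke

/-! ### The bound for the order -/

section Counting

theorem GeneratedByAtMost.finite_and_card_le {G : Type*} [CommGroup G] {r t : ℕ} (ht : 0 < t)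
    (hG : GeneratedByAtMost G r) (h : ∀ g : G, g ^ t = 1) : Finite G ∧ Nat.card G ≤ t ^ r := by
  obtain ⟨S, hS, htop⟩ := hG
  have : Group.FG G := Group.fg_iff'.2 ⟨S.card, S, rfl, htop⟩
  have hd := card_dvd_exponent_pow_rank' G h
  have hrank : Group.rank G ≤ r := (Group.rank_le htop).trans hS
  refine ⟨Nat.finite_of_card_ne_zero (ne_zero_of_dvd_ne_zero (pow_pos ht _).ne' hd), ?_⟩
  exact (Nat.le_of_dvd (pow_pos ht _) hd).trans (Nat.pow_le_pow_right ht hrank)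

variable {A : Type*} [CommRing A] {q : A} {C : Type*} [CommGroup C]
  {φ : SLCong 2 (Ideal.span {q}) →* C}

namespace IsMennickeHom

/-- The symbol modulo `h`, as a homomorphism on the units modulo `h`. -/
noncomputable def unitsHom (hφ : IsMennickeHom q φ) (hGEN : GEN A 2 1) {h : A} (hh : q ∣ h - 1) :
    (A ⧸ Ideal.span {h})ˣ →* C :=
  MonoidHom.mk' (fun u => residueSymb φ h (Function.surjInv Ideal.Quotient.mk_surjective
      (u : A ⧸ Ideal.span {h}))) fun u v => by
    have hs := Function.surjInv_eq (Ideal.Quotient.mk_surjective (I := Ideal.span {h}))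
    have hc : ∀ w : (A ⧸ Ideal.span {h})ˣ, IsCoprime h
        (Function.surjInv Ideal.Quotient.mk_surjective (w : A ⧸ Ideal.span {h})) := fun w =>
      isCoprime_of_isUnit_mk (by rw [hs]; exact w.isUnit)
    rw [← hφ.residueSymb_mul hGEN hh (hc u) (hc v)]
    refine hφ.residueSymb_congr hh ((hc u).mul_right (hc v)) (mk_eq_mk_iff_dvd.1 ?_)
    rw [map_mul, hs, hs, hs, Units.val_mul]

theorem unitsHom_apply (hφ : IsMennickeHom q φ) (hGEN : GEN A 2 1) {h b : A} (hb : IsRow q h b)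
    (u : (A ⧸ Ideal.span {h})ˣ) (hu : (u : A ⧸ Ideal.span {h}) = Ideal.Quotient.mk _ b) :
    hφ.unitsHom hGEN hb.dvd_sub_one u = symb φ h b := by
  rw [← hφ.residueSymb_of_isRow hb]
  refine hφ.residueSymb_congr hb.dvd_sub_one hb.coprime (mk_eq_mk_iff_dvd.1 ?_)
  rw [Function.surjInv_eq Ideal.Quotient.mk_surjective, hu]

theorem unitsHom_pow_eq_one (hφ : IsMennickeHom q φ) (hq : q ≠ 0) (hGEN : GEN A 2 1) {t l : ℕ}
    (hEXP : EXP A t l) {h : A} (hh : q ∣ h - 1) (u : (A ⧸ Ideal.span {h})ˣ) :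
    hφ.unitsHom hGEN hh u ^ t = 1 := by
  have hs := Function.surjInv_eq (Ideal.Quotient.mk_surjective (I := Ideal.span {h}))
    (u : A ⧸ Ideal.span {h})
  obtain ⟨T, h0, h1⟩ := (isRow_mul_one_sub hh
    (isCoprime_of_isUnit_mk (by rw [hs]; exact u.isUnit))).exists_mem
  rw [← hφ.pow_eq_one hq hGEN hEXP T, hφ.eq_symb T h0 h1]
  rfl

variable [IsDomain A]

/-- Finitely many symbols can be written with a common first entry. In the inductive step, stable
range `1` moves the second entry `q β` of the new symbol, so that `β` becomes coprime to the
second entries used before; the two first entries are then joined by the Chinese remainder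
theorem. -/
theorem exists_common_left (hφ : IsMennickeHom q φ)
    (hSR : ∀ B : A, B ≠ 0 → SR (A ⧸ Ideal.span {B}) 1)
    (F : Finset (SLCong 2 (Ideal.span {q}))) :
    ∃ a B : A, q ∣ a - 1 ∧ B ≠ 0 ∧ IsCoprime a B ∧
      ∀ T ∈ F, ∃ b, IsRow q a b ∧ b ∣ q * B ∧ φ T = symb φ a b := by
  classical
  induction F using Finset.induction_on with
  | empty => exact ⟨1, 1, by simp, one_ne_zero, isCoprime_one_right, by simp⟩
  | insert T F hT ih =>
    obtain ⟨a, B, ⟨α, hα⟩, hB, haB, hF⟩ := ih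
    have hrow := isRow_of_mem T
    obtain ⟨β₀, hβ₀⟩ := hrow.dvd
    obtain ⟨α₀, hα₀⟩ := hrow.dvd_sub_one
    set a₀ := T.1 0 0 with ha₀
    have hc : IsCoprime a₀ β₀ := by
      have := hrow.coprime
      rw [hβ₀] at this
      exact this.of_mul_right_right
    obtain ⟨k, hk, hk0⟩ : ∃ k, IsCoprime B (β₀ + k * a₀) ∧ β₀ + k * a₀ ≠ 0 := by
      obtain ⟨k, hk⟩ := SR.exists_isCoprime_add_mul (hSR B hB) hc
      by_cases h0 : β₀ + k * a₀ = 0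
      · -- here `B` and `a₀` are units, and `a₀` replaces the second entry `0`
        rw [h0, isCoprime_zero_right] at hk
        have hu : IsCoprime a₀ (β₀ + k * a₀) := hc.add_mul_right_right k
        rw [h0, isCoprime_zero_right] at hu
        refine ⟨k + 1, ?_, ?_⟩
        · exact (isCoprime_one_left.of_isCoprime_of_dvd_left hk.dvd)
        · rw [show β₀ + (k + 1) * a₀ = a₀ by linear_combination h0]
          exact hu.ne_zero
      · exact ⟨k, hk, h0⟩
    set β := β₀ + k * a₀ with hβ
    have hcβ : IsCoprime a₀ β := hc.add_mul_right_right k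
    obtain ⟨x, y, hxy⟩ := hk
    set a' := 1 + q * (α * (y * β) + α₀ * (x * B)) with ha'
    have e₁ : a' - a = q * B * (x * (α₀ - α)) := by
      rw [ha']; linear_combination q * α * hxy - hα
    have e₂ : a' - a₀ = q * β * (y * (α - α₀)) := by
      rw [ha']; linear_combination q * α₀ * hxy - hα₀
    have hq₁ : q ∣ a' - 1 := ⟨α * (y * β) + α₀ * (x * B), by rw [ha']; ring⟩
    have c₁ : IsCoprime a' B := by
      rw [show a' = a + B * (q * (x * (α₀ - α))) by linear_combination e₁]
      exact haB.add_mul_left_left _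
    have c₂ : IsCoprime a' β := by
      rw [show a' = a₀ + β * (q * (y * (α - α₀))) by linear_combination e₂]
      exact hcβ.add_mul_left_left _
    refine ⟨a', B * β, hq₁, mul_ne_zero hB hk0, c₁.mul_right c₂, fun S hS => ?_⟩
    rcases Finset.mem_insert.1 hS with rfl | hS
    · have h₁ : a₀ ∣ q * β - S.1 0 1 := ⟨q * k, by rw [hβ, hβ₀]; ring⟩
      have hr := hrow.congr_right (dvd_mul_right q β) h₁
      have h₂ : q * β ∣ a' - a₀ := ⟨_, e₂⟩
      refine ⟨q * β, hr.congr_left h₂, ⟨B, by ring⟩, ?_⟩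
      rw [hφ.symb_congr_left hr h₂, hφ.symb_congr_right hrow (dvd_mul_right q β) h₁]
      exact hφ.eq_symb S rfl rfl
    · obtain ⟨b, hb, hbB, e⟩ := hF S hS
      have h : b ∣ a' - a := hbB.trans ⟨_, e₁⟩
      exact ⟨b, hb.congr_left h, hbB.trans ⟨β, by ring⟩, by rw [hφ.symb_congr_left hb h, e]⟩

/-- Once the elements of `F` are represented with a common first entry, their values lie in the
image of the units modulo some `h`, modulo `t`-th powers. -/
theorem card_image_le [DecidableEq C] (hφ : IsMennickeHom q φ) (hq : q ≠ 0)
    (hSR : ∀ B : A, B ≠ 0 → SR (A ⧸ Ideal.span {B}) 1) (hGEN2 : GEN A 2 1) {t r l : ℕ}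
    (ht : 0 < t) (hGEN : GEN A t r) (hEXP : EXP A t l) (F : Finset (SLCong 2 (Ideal.span {q}))) :
    (F.image φ).card ≤ t ^ r := by
  obtain ⟨a, B, ha, -, haB, hF⟩ := hφ.exists_common_left hSR F
  have haq : IsCoprime a q := by
    obtain ⟨k, hk⟩ := ha
    exact ⟨1, -k, by linear_combination hk⟩
  obtain ⟨h, hha, hgen⟩ := hGEN a (q * B) (haq.mul_right haB)
  rw [Ideal.mem_span_singleton] at hha
  have hh : q ∣ h - 1 := by
    rw [show h - 1 = (h - a) + (a - 1) by ring]
    exact dvd_add ((dvd_mul_right q B).trans hha) ha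
  set N := (powMonoidHom t : (A ⧸ Ideal.span {h})ˣ →* (A ⧸ Ideal.span {h})ˣ).range with hN
  have hpow : ∀ g : (A ⧸ Ideal.span {h})ˣ ⧸ N, g ^ t = 1 := by
    intro g
    obtain ⟨g, rfl⟩ := QuotientGroup.mk_surjective g
    rw [← QuotientGroup.mk_pow, QuotientGroup.eq_one_iff]
    exact ⟨g, rfl⟩
  obtain ⟨hfin, hcard⟩ := GeneratedByAtMost.finite_and_card_le
    (G := (A ⧸ Ideal.span {h})ˣ ⧸ N) ht hgen hpow
  have hker : N ≤ (hφ.unitsHom hGEN2 hh).ker := by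
    rintro _ ⟨v, rfl⟩
    rw [MonoidHom.mem_ker, powMonoidHom_apply, map_pow,
      hφ.unitsHom_pow_eq_one hq hGEN2 hEXP hh v]
  set ψ := QuotientGroup.lift N _ hker with hψ
  have hsub : ((F.image φ : Finset C) : Set C) ⊆ Set.range ψ := by
    intro c hc
    obtain ⟨T, hT, rfl⟩ := Finset.mem_image.1 (Finset.mem_coe.1 hc)
    obtain ⟨b, hb, hbB, e⟩ := hF T hT
    have hd : b ∣ h - a := hbB.trans hha
    have hb' := hb.congr_left hd
    obtain ⟨u, hu⟩ := isUnit_mk_of_isCoprime hb'.coprime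
    refine ⟨(u : (A ⧸ Ideal.span {h})ˣ ⧸ N), ?_⟩
    rw [e, ← hφ.symb_congr_left hb hd]
    exact hφ.unitsHom_apply hGEN2 hb' u hu
  calc (F.image φ).card = ((F.image φ : Finset C) : Set C).ncard := (Set.ncard_coe_finset _).symm
    _ ≤ (Set.range ψ).ncard := Set.ncard_le_ncard hsub (Set.finite_range ψ)
    _ ≤ Nat.card ((A ⧸ Ideal.span {h})ˣ ⧸ N) := Finite.card_range_le ψ
    _ ≤ t ^ r := hcard

theorem finite_and_card_le (hφ : IsMennickeHom q φ) (hsurj : Function.Surjective φ) (hq : q ≠ 0)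
    (hSR : ∀ B : A, B ≠ 0 → SR (A ⧸ Ideal.span {B}) 1) (hGEN2 : GEN A 2 1) {t r l : ℕ}
    (ht : 0 < t) (hGEN : GEN A t r) (hEXP : EXP A t l) : Finite C ∧ Nat.card C ≤ t ^ r := by
  classical
  have key : ∀ s : Finset C, s.card ≤ t ^ r := by
    intro s
    have hs : (s.image (Function.surjInv hsurj)).image φ = s := by
      rw [Finset.image_image, (Function.rightInverse_surjInv hsurj).comp_eq_id, Finset.image_id]
    rw [← hs]
    exact hφ.card_image_le hq hSR hGEN2 ht hGEN hEXP _
  have hfin : Finite C := by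
    by_contra hinf
    rw [not_finite_iff_infinite] at hinf
    obtain ⟨s, hs⟩ := Infinite.exists_subset_card_eq C (t ^ r + 1)
    have := key s
    omega
  refine ⟨hfin, ?_⟩
  have := Fintype.ofFinite C
  rw [Nat.card_eq_fintype_card, ← Finset.card_univ]
  exact key _

end IsMennickeHom

end Counting

section Quotient

variable {A : Type*} [CommRing A] [IsDomain A]

namespace DeepTrivial

theorem subgroupOf_normal (hA : DeepTrivial A) {𝔮 : Ideal A} (h𝔮 : 𝔮 ≠ ⊥) :
    ((ElemNormal 2 𝔮).subgroupOf (SLCong 2 𝔮)).Normal := by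
  refine ⟨fun n hn g => ?_⟩
  rw [Subgroup.mem_subgroupOf] at hn ⊢
  simpa using hA.normal h𝔮 (inv_mem g.2) hn

theorem mk_eq_mk_of_mem (hA : DeepTrivial A) {𝔮 : Ideal A} (h𝔮 : 𝔮 ≠ ⊥) {T T' : SLCong 2 𝔮}
    {n n' : Matrix.SpecialLinearGroup (Fin 2) A} (hn : n ∈ ElemNormal 2 𝔮)
    (hn' : n' ∈ ElemNormal 2 𝔮) (h : T'.1 = n * T.1 * n') :
    (T' : SLCong 2 𝔮 ⧸ (ElemNormal 2 𝔮).subgroupOf (SLCong 2 𝔮)) = T := by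
  rw [eq_comm, QuotientGroup.eq, Subgroup.mem_subgroupOf]
  have : (T⁻¹ * T').1 = (T.1⁻¹ * n * T.1) * n' := by
    rw [Subgroup.coe_mul, Subgroup.coe_inv, h]; group
  rw [this]
  exact mul_mem (hA.normal h𝔮 T.2 hn) hn'

theorem finite_and_card_le (hA : DeepTrivial A) {t r l : ℕ} (ht : 0 < t) (hGEN2 : GEN A 2 1)
    (hGEN : GEN A t r) (hEXP : EXP A t l) {𝔮 : Ideal A} (h𝔮 : 𝔮 ≠ ⊥) :
    Finite (SLCong 2 𝔮 ⧸ (ElemNormal 2 𝔮).subgroupOf (SLCong 2 𝔮)) ∧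
      Nat.card (SLCong 2 𝔮 ⧸ (ElemNormal 2 𝔮).subgroupOf (SLCong 2 𝔮)) ≤ t ^ r := by
  have hN := hA.subgroupOf_normal h𝔮
  set N := (ElemNormal 2 𝔮).subgroupOf (SLCong 2 𝔮) with hNd
  let comm : CommGroup (SLCong 2 𝔮 ⧸ N) :=
    { (inferInstance : Group (SLCong 2 𝔮 ⧸ N)) with
      mul_comm := by
        intro x y
        obtain ⟨x, rfl⟩ := QuotientGroup.mk_surjective x
        obtain ⟨y, rfl⟩ := QuotientGroup.mk_surjective y
        rw [← QuotientGroup.mk_mul, ← QuotientGroup.mk_mul, eq_comm, QuotientGroup.eq, hNd,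
          Subgroup.mem_subgroupOf]
        have h := hA.commutator_mem h𝔮 x.2 (g := y.1) fun n hn => hA.normal h𝔮 y.2 hn
        simpa [mul_assoc] using h }
  obtain ⟨q, hq, hq0⟩ := Submodule.exists_mem_ne_zero_of_ne_bot h𝔮
  have hle : Ideal.span {q} ≤ 𝔮 := (Ideal.span_singleton_le_iff_mem _).2 hq
  let φ : SLCong 2 (Ideal.span {q}) →* SLCong 2 𝔮 ⧸ N :=
    (QuotientGroup.mk' N).comp (Subgroup.inclusion (SLCong_mono hle))
  have hφ : IsMennickeHom q φ := by
    refine ⟨fun T hT => ?_, fun T T' g hg h => ?_, fun u hu T T' hT h00 h01 h10 h11 => ?_⟩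
    · exact (QuotientGroup.eq_one_iff _).2 (ElemNormal_mono hle hT)
    · refine (QuotientGroup.eq.2 ?_).symm
      have hc := hA.commutator_mem h𝔮 (SLCong_mono hle T.2) (g := g)
        fun n hn => ElemNormal_conj hg hn
      rw [← h] at hc
      exact hc
    · obtain ⟨n, hn, n', hn', e⟩ := hA.diag_conj hu hq0 hT h00 h01 h10 h11
      exact hA.mk_eq_mk_of_mem h𝔮 (ElemNormal_mono hle hn) (ElemNormal_mono hle hn') e
  have hsurj : Function.Surjective φ := by
    intro c
    obtain ⟨T, rfl⟩ := QuotientGroup.mk_surjective c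
    obtain ⟨n, hn, h⟩ := hA.exists_mul_mem hq0 T.2
    refine ⟨⟨T.1 * n, h⟩, hA.mk_eq_mk_of_mem h𝔮 (one_mem _) hn ?_⟩
    rw [one_mul]
    rfl
  exact hφ.finite_and_card_le hsurj hq0 (fun B hB => hA.sr_span hB) hGEN2 ht hGEN hEXP

end DeepTrivial

end Quotient

end BoundedGen

theorem mainTheorem7 {A : Type*} [CommRing A] [IsDomain A] (r x l t z : ℕ)
    (hr : 0 < r) (hx : 0 < x) (hl : 0 < l) (ht : 0 < t) (hz : 0 < z)
    (hSR : BoundedGen.SROneHalf A)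
    (hGEN2 : BoundedGen.GEN A 2 1) (hGEN : BoundedGen.GEN A t r)
    (hEXP : BoundedGen.EXP A t l)
    (hUNIT : BoundedGen.UNIT A 1 x)
    (hCONJ : BoundedGen.CONJ A z)
    (𝔮 : Ideal A) (h𝔮 : 𝔮 ≠ ⊥) :
    ((BoundedGen.ElemNormal 2 𝔮).subgroupOf (BoundedGen.SLCong 2 𝔮)).Normal ∧
    Finite (BoundedGen.SLCong 2 𝔮 ⧸
      (BoundedGen.ElemNormal 2 𝔮).subgroupOf (BoundedGen.SLCong 2 𝔮)) ∧
    Nat.card (BoundedGen.SLCong 2 𝔮 ⧸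
      (BoundedGen.ElemNormal 2 𝔮).subgroupOf (BoundedGen.SLCong 2 𝔮)) ≤ t ^ r := by
  have hA := BoundedGen.DeepTrivial.of_unit hSR hUNIT
  exact ⟨hA.subgroupOf_normal h𝔮, hA.finite_and_card_le ht hGEN2 hGEN hEXP h𝔮⟩
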